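/- Let $n\ge 0$ be an integer, let $a_1,\dots,a_n$ be real numbers, and let $\varepsilon_1,\dots,\varepsilon_n$ be independent random variables with $\mathbf P(\varepsilon_i=1)=\mathbf P(\varepsilon_i=-1)=\frac12$. Let $a_1^*\ge a_2^*\ge\dots\ge a_n^*$ be the nonincreasing rearrangement of $|a_1|,\dots,|a_n|$. For real $p\ge 2$ write $\|X\|_p=(\mathbf E|X|^p)^{1/p}$, and let $\gamma_p=\|g\|_p$, where $g$ is a standard Gaussian $\mathcal N(0,1)$ random variable. Then for every real $p\ge2$, $$ \max\bigg\{\gamma_p\bigg(\sum_{\lceil p/2\rceil\le i\le n}(a_i^*)^2\bigg)^{1/2},\ \frac1{\sqrt2}\sum_{1\le i\le n,\ i<\lceil p/2\rceil}a_i^*\bigg\} \le\bigg\|\sum_{i=1}^n a_i\varepsilon_i\bigg\|_p \le\gamma_p\bigg(\sum_{\lceil p/2\rceil\le i\le n}(a_i^*)^2\bigg)^{1/2}+\sum_{1\le i\le n,\ i<\lceil p/2\rceil}a_i^*, $$ where an empty sum is $0$. -/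

import Mathlib

open MeasureTheory ProbabilityTheory
open scoped ENNReal

/-- Independent symmetric random variables with values `±1` (up to null sets). -/
structure IsBernoulliFamily {Ω : Type*} [MeasurableSpace Ω] (μ : Measure Ω)
    {ι : Type*} (ε : ι → Ω → ℝ) : Prop where
  measurable : ∀ i, Measurable (ε i)
  prob_one : ∀ i, μ {ω | ε i ω = 1} = 1 / 2
  prob_neg_one : ∀ i, μ {ω | ε i ω = -1} = 1 / 2
  indep : iIndepFun ε μ

/-- The nonincreasing rearrangement of `(|a i|)`, indexed from `0`: the value at `i` is the
`(i + 1)`-st largest of the `|a j|`. (`Tuple.sort f` is a permutation making `f ∘ Tuple.sort f`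
monotone.) -/
noncomputable def nonincRearrangement {n : ℕ} (a : Fin n → ℝ) : Fin n → ℝ :=
  fun i => |a (Tuple.sort (fun j => -|a j|) i)|

theorem nonincRearrangement_antitone {n : ℕ} (a : Fin n → ℝ) :
    Antitone (nonincRearrangement a) := by
  intro i j hij
  have h := Tuple.monotone_sort (fun j => -|a j|) hij
  simpa [nonincRearrangement] using h

/-- `γ_p`, the `L^p` norm of a standard Gaussian random variable. -/
noncomputable def gaussianNorm (p : ℝ) : ℝ :=
  lpNorm (fun x : ℝ => x) (ENNReal.ofReal p) (gaussianReal 0 1)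

open scoped NNReal

/-! Independence turns every moment of the sum into a finite average over signs (`radMean`), and one
may take the coefficients to be nonnegative and sorted.

Gaussian lower bound: with S the signed sum and S_i the sum without its i-th term, discrete
integration by parts (`radMean_id_mul`) and convexity give E|S|^p ≥ (p - 1) ∑ a_i² E|S_i|^(p-2) for
p ≥ 4. The Gaussian moments satisfy the matching recursion with factor p - 1, so p descends by 2
while one index is deleted, until 2 ≤ p < 4. At p = 2 nothing is lost. For 2 < p < 4 the moment is
an integral of ∏ cos(t a_i) against t^(-p-1), and comparing the cosines with a Gaussian
characteristic function costs only the largest coefficient (`le_radMean_of_lt_four`). In all, fewer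
than p/2 indices are deleted, and the worst deletion is that of the largest coefficients.

Other lower bound: keep only the head, which has fewer than p/2 terms. All its signs agree with +
with probability above 2^(-p/2), whence the factor 1/√2.

Upper bound: for p ≥ 4, u ↦ E|x + √u ε|^p is convex, so signs can be replaced by Gaussians of the
same variance (`radMean_abs_rpow_le`); the triangle inequality splits off the head. For 2 < p < 4
the head is a single term, and either the fourth moment or the cosine comparison suffices
(`IsBernoulliFamily.lpNorm_le_of_lt_four`). -/

/-- The average of `f (∑ i ∈ s, ±a i)` over all choices of signs. -/
noncomputable def radMean {ι : Type*} [DecidableEq ι] (a : ι → ℝ) (s : Finset ι) (f : ℝ → ℝ) : ℝ :=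
  (∑ t ∈ s.powerset, f (∑ i ∈ t, a i - ∑ i ∈ s \ t, a i)) / 2 ^ s.card

/-! ### Averages over signs -/

section radMean
variable {ι : Type*} [DecidableEq ι] {a : ι → ℝ} {s : Finset ι} {f g : ℝ → ℝ}

@[simp] theorem radMean_empty : radMean a ∅ f = f 0 := by simp [radMean]

theorem radMean_insert {i : ι} (hi : i ∉ s) :
    radMean a (insert i s) f
      = (radMean a s (fun x => f (x + a i)) + radMean a s (fun x => f (x - a i))) / 2 := by
  unfold radMean
  rw [Finset.sum_powerset_insert hi, Finset.card_insert_of_notMem hi]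
  have h1 : ∀ t ∈ s.powerset, f (∑ j ∈ t, a j - ∑ j ∈ insert i s \ t, a j)
      = f (∑ j ∈ t, a j - ∑ j ∈ s \ t, a j - a i) := by
    intro t ht
    have hit : i ∉ t := fun h => hi (Finset.mem_powerset.1 ht h)
    rw [Finset.insert_sdiff_of_notMem _ hit, Finset.sum_insert (by simp [hi])]
    congr 1; ring
  have h2 : ∀ t ∈ s.powerset, f (∑ j ∈ insert i t, a j - ∑ j ∈ insert i s \ insert i t, a j)
      = f (∑ j ∈ t, a j - ∑ j ∈ s \ t, a j + a i) := by
    intro t ht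
    have hit : i ∉ t := fun h => hi (Finset.mem_powerset.1 ht h)
    rw [Finset.sum_insert hit]
    have : insert i s \ insert i t = s \ t := by
      ext j; by_cases hj : j = i
      · subst hj; simp [hi]
      · simp [hj]
    rw [this]
    congr 1; ring
  rw [Finset.sum_congr rfl h1, Finset.sum_congr rfl h2, pow_succ]
  field_simp
  ring

theorem radMean_mono (h : ∀ x, f x ≤ g x) : radMean a s f ≤ radMean a s g := by
  unfold radMean
  gcongr with t ht
  exact h _

theorem radMean_nonneg (h : ∀ x, 0 ≤ f x) : 0 ≤ radMean a s f :=
  div_nonneg (Finset.sum_nonneg fun _ _ => h _) (by positivity)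

theorem radMean_add : radMean a s (fun x => f x + g x) = radMean a s f + radMean a s g := by
  simp [radMean, Finset.sum_add_distrib, add_div]

theorem radMean_mul_const (c : ℝ) : radMean a s (fun x => f x * c) = radMean a s f * c := by
  simp only [radMean, ← Finset.sum_mul]; ring

theorem radMean_const (c : ℝ) : radMean a s (fun _ => c) = c := by
  simp [radMean, Finset.card_powerset]

theorem radMean_abs : radMean (fun i => |a i|) s f = radMean a s f := by
  induction s using Finset.induction_on generalizing f with
  | empty => simp
  | insert i s hi ih =>
    rw [radMean_insert hi, radMean_insert hi, ih, ih]
    rcases abs_choice (a i) with h | h <;> simp only [h]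
    simp only [← sub_eq_add_neg, sub_neg_eq_add, add_comm]

theorem radMean_cos (t : ℝ) :
    radMean a s (fun x => Real.cos (t * x)) = ∏ i ∈ s, Real.cos (t * a i) := by
  induction s using Finset.induction_on with
  | empty => simp
  | insert i s hi ih =>
    rw [radMean_insert hi, Finset.prod_insert hi, ← radMean_add, ← ih, mul_comm, ← radMean_mul_const,
      div_eq_mul_inv, ← radMean_mul_const]
    congr 1; funext x
    rw [mul_add, mul_sub, Real.cos_add, Real.cos_sub]; ring

theorem radMean_sq : radMean a s (fun x => x ^ 2) = ∑ i ∈ s, a i ^ 2 := by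
  induction s using Finset.induction_on with
  | empty => simp
  | insert i s hi ih =>
    rw [radMean_insert hi, Finset.sum_insert hi, ← radMean_add, ← ih, ← radMean_const (a := a) (s := s)
      (a i ^ 2), ← radMean_add, div_eq_mul_inv, ← radMean_mul_const]
    congr 1; funext x; ring

theorem radMean_insert_pow_four {i : ι} (hi : i ∉ s) :
    radMean a (insert i s) (fun x => x ^ 4)
      = radMean a s (fun x => x ^ 4) + 6 * a i ^ 2 * ∑ j ∈ s, a j ^ 2 + a i ^ 4 := by
  rw [radMean_insert hi, ← radMean_sq, ← radMean_add, mul_comm, ← radMean_mul_const,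
    ← radMean_add, ← radMean_const (a := a) (s := s) (a i ^ 4), ← radMean_add, div_eq_mul_inv,
    ← radMean_mul_const]
  congr 1; funext x; ring

theorem radMean_pow_four_le : radMean a s (fun x => x ^ 4) ≤ 3 * (∑ i ∈ s, a i ^ 2) ^ 2 := by
  induction s using Finset.induction_on with
  | empty => simp
  | insert i s hi ih =>
    rw [radMean_insert_pow_four hi, Finset.sum_insert hi]
    nlinarith [sq_nonneg (a i ^ 2)]

/-- Discrete integration by parts. -/
theorem radMean_id_mul (h : ℝ → ℝ) :
    radMean a s (fun x => x * h x)
      = ∑ i ∈ s, a i * radMean a (s.erase i) (fun x => (h (x + a i) - h (x - a i)) / 2) := by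
  induction s using Finset.induction_on generalizing h with
  | empty => simp
  | insert j s hj ih =>
    have e1 : (fun x => (x + a j) * h (x + a j)) = fun x => x * h (x + a j) + h (x + a j) * a j := by
      funext x; ring
    have e2 : (fun x => (x - a j) * h (x - a j))
        = fun x => x * h (x - a j) + h (x - a j) * (- a j) := by
      funext x; ring
    rw [radMean_insert hj, e1, e2, radMean_add, radMean_add, radMean_mul_const, radMean_mul_const,
      ih, ih, Finset.sum_insert hj, Finset.erase_insert hj]
    have e3 : radMean a s (fun x => (h (x + a j) - h (x - a j)) / 2)
        = (radMean a s (fun x => h (x + a j)) - radMean a s (fun x => h (x - a j))) / 2 := by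
      simp only [radMean, ← Finset.sum_div, Finset.sum_sub_distrib]; ring
    -- For i ≠ j the sign of j is still averaged over; the two values of that sign match the two
    -- uses of the induction hypothesis, at the translates of h by ± a j.
    have e4 : ∀ i ∈ s, a i * radMean a ((insert j s).erase i)
          (fun x => (h (x + a i) - h (x - a i)) / 2)
        = (a i * radMean a (s.erase i) (fun x => (h (x + a i + a j) - h (x - a i + a j)) / 2)
          + a i * radMean a (s.erase i)
            (fun x => (h (x + a i - a j) - h (x - a i - a j)) / 2)) / 2 := by
      intro i hi
      have hij : j ≠ i := fun h => hj (h ▸ hi)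
      rw [Finset.erase_insert_of_ne hij, radMean_insert (by simp [hj])]
      have : ∀ x, x + a j + a i = x + a i + a j := fun x => by ring
      have : ∀ x, x + a j - a i = x - a i + a j := fun x => by ring
      have : ∀ x, x - a j + a i = x + a i - a j := fun x => by ring
      have : ∀ x, x - a j - a i = x - a i - a j := fun x => by ring
      simp only [*]
      ring
    rw [Finset.sum_congr rfl e4, e3, ← Finset.sum_div, Finset.sum_add_distrib]
    ring

/-- Jensen's inequality in the extra sign, conditionally on the others. -/
theorem radMean_le_insert (hf : ∀ x u, f x ≤ (f (x + u) + f (x - u)) / 2) (i : ι) :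
    radMean a s f ≤ radMean a (insert i s) f := by
  by_cases hi : i ∈ s
  · rw [Finset.insert_eq_of_mem hi]
  · rw [radMean_insert hi, ← radMean_add, div_eq_mul_inv, ← radMean_mul_const]
    refine radMean_mono fun x => ?_
    have := hf x (a i)
    linarith

theorem radMean_le_of_subset (hf : ∀ x u, f x ≤ (f (x + u) + f (x - u)) / 2) {t : Finset ι}
    (hst : s ⊆ t) : radMean a s f ≤ radMean a t f := by
  have key : ∀ r : Finset ι, radMean a s f ≤ radMean a (r ∪ s) f := by
    intro r
    induction r using Finset.induction_on with
    | empty => simp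
    | insert i r _ ih =>
      rw [Finset.insert_union]
      exact ih.trans (radMean_le_insert hf i)
  simpa [Finset.union_eq_left.2 hst] using key t

/-- Only the choice of all plus signs is kept. -/
theorem div_two_pow_le_radMean (hf : ∀ x, 0 ≤ f x) :
    f (∑ i ∈ s, a i) / 2 ^ s.card ≤ radMean a s f := by
  unfold radMean
  gcongr
  have := Finset.single_le_sum (f := fun t => f (∑ i ∈ t, a i - ∑ i ∈ s \ t, a i))
    (fun _ _ => hf _) (Finset.mem_powerset_self s)
  simpa using this

theorem abs_rpow_midpoint_le {p : ℝ} (hp : 1 ≤ p) (x u : ℝ) :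
    |x| ^ p ≤ (|x + u| ^ p + |x - u| ^ p) / 2 := by
  have h := (convexOn_rpow hp).2 (abs_nonneg (x + u)) (abs_nonneg (x - u))
    (by norm_num : (0:ℝ) ≤ 1 / 2) (by norm_num : (0:ℝ) ≤ 1 / 2) (by norm_num)
  simp only [smul_eq_mul] at h
  have h2 : |x| ≤ 1 / 2 * |x + u| + 1 / 2 * |x - u| := by
    have := abs_add_le (x + u) (x - u)
    have e : x + u + (x - u) = 2 * x := by ring
    rw [e, abs_mul, abs_two] at this
    linarith
  have := Real.rpow_le_rpow (abs_nonneg x) h2 (by linarith : 0 ≤ p)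
  linarith

end radMean

/-! ### From random signs to finite averages -/

section Bernoulli
variable {Ω : Type*} [MeasurableSpace Ω] {μ : Measure Ω} [IsProbabilityMeasure μ]
  {ι : Type*} {ε : ι → Ω → ℝ}

theorem IsBernoulliFamily.ae_eq (hε : IsBernoulliFamily μ ε) (i : ι) :
    ∀ᵐ ω ∂μ, ε i ω = 1 ∨ ε i ω = -1 := by
  have m1 : MeasurableSet {ω | ε i ω = 1} := hε.measurable i (measurableSet_singleton 1)
  have m2 : MeasurableSet {ω | ε i ω = -1} := hε.measurable i (measurableSet_singleton (-1))
  have hd : Disjoint {ω | ε i ω = 1} {ω | ε i ω = -1} := by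
    rw [Set.disjoint_left]
    intro ω h1 h2
    simp only [Set.mem_ofPred_eq] at h1 h2
    rw [h1] at h2; norm_num at h2
  have h : μ ({ω | ε i ω = 1} ∪ {ω | ε i ω = -1}) = 1 := by
    rw [measure_union hd m2, hε.prob_one, hε.prob_neg_one]
    exact ENNReal.add_halves 1
  exact (prob_compl_eq_zero_iff (m1.union m2)).2 h

theorem IsBernoulliFamily.integral_eq_zero (hε : IsBernoulliFamily μ ε) (i : ι) :
    ∫ ω, ε i ω ∂μ = 0 := by
  have m1 : MeasurableSet {ω | ε i ω = 1} := hε.measurable i (measurableSet_singleton 1)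
  have m2 : MeasurableSet {ω | ε i ω = -1} := hε.measurable i (measurableSet_singleton (-1))
  have e : ε i =ᵐ[μ] fun ω => Set.indicator {ω | ε i ω = 1} (fun _ => (1:ℝ)) ω
      - Set.indicator {ω | ε i ω = -1} (fun _ => (1:ℝ)) ω := by
    filter_upwards [hε.ae_eq i] with ω h
    rcases h with h | h <;> simp [h, Set.indicator] <;> norm_num
  rw [integral_congr_ae e, integral_sub ((integrable_const _).indicator m1)
    ((integrable_const _).indicator m2), integral_indicator m1, integral_indicator m2]
  simp [Measure.real, hε.prob_one, hε.prob_neg_one]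

theorem IsBernoulliFamily.ae_abs_sum_le (hε : IsBernoulliFamily μ ε) (a : ι → ℝ) (s : Finset ι) :
    ∀ᵐ ω ∂μ, |∑ i ∈ s, a i * ε i ω| ≤ ∑ i ∈ s, |a i| := by
  have h : ∀ᵐ ω ∂μ, ∀ i ∈ s, ε i ω = 1 ∨ ε i ω = -1 :=
    (ae_ball_iff s.countable_toSet).2 fun i _ => hε.ae_eq i
  filter_upwards [h] with ω h
  refine (Finset.abs_sum_le_sum_abs _ _).trans (Finset.sum_le_sum fun i hi => ?_)
  rcases h i hi with h | h <;> simp [h]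

theorem IsBernoulliFamily.memLp (hε : IsBernoulliFamily μ ε) (a : ι → ℝ) (s : Finset ι)
    (q : ℝ≥0∞) : MemLp (fun ω => ∑ i ∈ s, a i * ε i ω) q μ := by
  have := hε.measurable
  exact MemLp.of_bound (by fun_prop) _ (hε.ae_abs_sum_le a s)

theorem IsBernoulliFamily.integrable_comp (hε : IsBernoulliFamily μ ε) (a : ι → ℝ) (s : Finset ι)
    {f : ℝ → ℝ} (hf : Continuous f) : Integrable (fun ω => f (∑ i ∈ s, a i * ε i ω)) μ := by
  have := hε.measurable
  have := hf.measurable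
  obtain ⟨C, hC⟩ := (isCompact_Icc (a := -∑ i ∈ s, |a i|) (b := ∑ i ∈ s, |a i|)).exists_bound_of_continuousOn
    hf.continuousOn
  refine Integrable.of_bound (by fun_prop) C ?_
  filter_upwards [hε.ae_abs_sum_le a s] with ω h
  exact hC _ (abs_le.1 h)

/-- For ε = ±1, f(S + aε) is the mean of f(S ± a) plus ε times half their difference. The last term
integrates to zero, since ε is centred and independent of S. -/
theorem IsBernoulliFamily.integral_comp_insert [DecidableEq ι] (hε : IsBernoulliFamily μ ε)
    (a : ι → ℝ) {s : Finset ι} {i : ι} (hi : i ∉ s) {f : ℝ → ℝ} (hf : Continuous f) :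
    ∫ ω, f (∑ j ∈ insert i s, a j * ε j ω) ∂μ
      = (∫ ω, f (∑ j ∈ s, a j * ε j ω + a i) ∂μ + ∫ ω, f (∑ j ∈ s, a j * ε j ω - a i) ∂μ) / 2 := by
  have hm := hε.measurable
  have hfm := hf.measurable
  have hfp : Continuous fun x => f (x + a i) := by fun_prop
  have hfn : Continuous fun x => f (x - a i) := by fun_prop
  have hind : IndepFun (fun ω => ∑ j ∈ s, a j * ε j ω) (ε i) μ := by
    -- Setting the coefficient at i to 1 makes the i-th member of the rescaled family `ε i` itself,
    -- even if `a i = 0`.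
    have h1 := hε.indep.comp (fun j x => Function.update a i 1 j * x) (fun j => by fun_prop)
    have h2 := h1.indepFun_finsetSum_of_notMem (fun j => by
      simp only [Function.comp_def]; fun_prop) hi
    convert h2 using 1
    · funext ω
      simp only [Finset.sum_apply, Function.comp]
      refine Finset.sum_congr rfl fun j hj => ?_
      rw [Function.update_of_ne (by rintro rfl; exact hi hj)]
    · funext ω; simp
  have key : ∀ F : ℝ → ℝ, Continuous F →
      ∫ ω, F (∑ j ∈ s, a j * ε j ω) * ε i ω ∂μ = 0 := by
    intro F hF
    have hFm := hF.measurable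
    have h1 : IndepFun (fun ω => F (∑ j ∈ s, a j * ε j ω)) (ε i) μ :=
      hind.comp (φ := F) (ψ := id) hFm measurable_id
    rw [h1.integral_fun_mul_eq_mul_integral (by fun_prop) (by fun_prop), hε.integral_eq_zero,
      mul_zero]
  have hint : ∀ F : ℝ → ℝ, Continuous F →
      Integrable (fun ω => F (∑ j ∈ s, a j * ε j ω) * ε i ω) μ := by
    intro F hF
    refine (hε.integrable_comp a s hF).mul_bdd (c := 1) (by fun_prop) ?_
    filter_upwards [hε.ae_eq i] with ω h
    rcases h with h | h <;> simp [h]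
  have e : (fun ω => f (∑ j ∈ insert i s, a j * ε j ω)) =ᵐ[μ] fun ω =>
      ((f (∑ j ∈ s, a j * ε j ω + a i) + f (∑ j ∈ s, a j * ε j ω - a i))
        + (f (∑ j ∈ s, a j * ε j ω + a i) * ε i ω - f (∑ j ∈ s, a j * ε j ω - a i) * ε i ω)) / 2 := by
    filter_upwards [hε.ae_eq i] with ω h
    rw [Finset.sum_insert hi]
    rcases h with h | h <;> rw [h]
    · rw [add_comm (a i * 1)]; ring_nf
    · rw [add_comm (a i * -1)]; ring_nf
  rw [integral_congr_ae e, integral_div, integral_add, integral_add, integral_sub, key _ hfp,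
    key _ hfn, sub_zero, add_zero]
  · exact hint _ hfp
  · exact hint _ hfn
  · exact hε.integrable_comp a s hfp
  · exact hε.integrable_comp a s hfn
  · exact (hε.integrable_comp a s hfp).add (hε.integrable_comp a s hfn)
  · exact (hint _ hfp).sub (hint _ hfn)

theorem IsBernoulliFamily.integral_comp_eq_radMean [DecidableEq ι] (hε : IsBernoulliFamily μ ε)
    (a : ι → ℝ) (s : Finset ι) {f : ℝ → ℝ} (hf : Continuous f) :
    ∫ ω, f (∑ j ∈ s, a j * ε j ω) ∂μ = radMean a s f := by
  induction s using Finset.induction_on generalizing f with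
  | empty => simp
  | insert i s hi ih =>
    rw [hε.integral_comp_insert a hi hf, radMean_insert hi,
      ih (f := fun x => f (x + a i)) (by fun_prop), ih (f := fun x => f (x - a i)) (by fun_prop)]

theorem IsBernoulliFamily.lpNorm_eq [DecidableEq ι] (hε : IsBernoulliFamily μ ε)
    (a : ι → ℝ) (s : Finset ι) {p : ℝ} (hp : 0 < p) :
    lpNorm (fun ω => ∑ j ∈ s, a j * ε j ω) (ENNReal.ofReal p) μ
      = radMean a s (fun x => |x| ^ p) ^ p⁻¹ := by
  rw [lpNorm_eq_integral_norm_rpow_toReal (by simpa using hp) (by simp)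
    (hε.memLp a s 1).aestronglyMeasurable, ENNReal.toReal_ofReal hp.le]
  simp only [Real.norm_eq_abs]
  rw [hε.integral_comp_eq_radMean a s (f := fun x => |x| ^ p)
    (continuous_abs.rpow_const fun _ => Or.inr hp.le)]

end Bernoulli

/-! ### Gaussian moments -/

/-- The absolute moment of order `p` of a standard Gaussian. -/
noncomputable def gaussianMoment (p : ℝ) : ℝ := ∫ x, |x| ^ p ∂gaussianReal 0 1

theorem gaussianNorm_eq {p : ℝ} (hp : 0 < p) : gaussianNorm p = gaussianMoment p ^ p⁻¹ := by
  rw [gaussianNorm, lpNorm_eq_integral_norm_rpow_toReal (by simpa using hp) (by simp)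
    (by fun_prop), ENNReal.toReal_ofReal hp.le]
  rfl

theorem gaussianMoment_nonneg (p : ℝ) : 0 ≤ gaussianMoment p :=
  integral_nonneg fun _ => by positivity

theorem gaussianMoment_eq_Gamma {p : ℝ} (hp : -1 < p) :
    gaussianMoment p = (Real.sqrt (2 * Real.pi))⁻¹ *
      (2 * ((1 / 2) ^ (-(p + 1) / 2) * (1 / 2) * Real.Gamma ((p + 1) / 2))) := by
  have h := integral_rpow_mul_exp_neg_mul_rpow (p := 2) (q := p) (b := 1 / 2) two_pos hp (by norm_num)
  rw [gaussianMoment, integral_gaussianReal_eq_integral_smul one_ne_zero, ← h,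
    ← integral_comp_abs (f := fun x : ℝ => x ^ p * Real.exp (-(1 / 2) * x ^ (2:ℝ))),
    ← integral_const_mul]
  refine integral_congr_ae (Filter.Eventually.of_forall fun x => ?_)
  simp only [gaussianPDFReal, smul_eq_mul, NNReal.coe_one, mul_one, sub_zero, Real.rpow_two, sq_abs]
  rw [show -x ^ 2 / 2 = -(1 / 2) * x ^ 2 by ring]
  ring

/-- This is Γ(s + 1) = s Γ(s), the Gaussian counterpart of the recursion obtained from
`radMean_id_mul`. -/
theorem gaussianMoment_eq_mul {p : ℝ} (hp : 1 < p) :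
    gaussianMoment p = (p - 1) * gaussianMoment (p - 2) := by
  rw [gaussianMoment_eq_Gamma (by linarith), gaussianMoment_eq_Gamma (by linarith)]
  have e : (p + 1) / 2 = (p - 1) / 2 + 1 := by ring
  have e2 : (p - 2 + 1) / 2 = (p - 1) / 2 := by ring
  have e3 : -(p + 1) / 2 = -(p - 2 + 1) / 2 + (-1) := by ring
  rw [e, e2, e3, Real.Gamma_add_one (by linarith), Real.rpow_add (by norm_num), Real.rpow_neg_one]
  ring

theorem gaussianMoment_two : gaussianMoment 2 = 1 := by
  rw [gaussianMoment_eq_mul (by norm_num)]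
  simp [gaussianMoment]; norm_num

theorem gaussianMoment_four : gaussianMoment 4 = 3 := by
  rw [gaussianMoment_eq_mul (by norm_num)]
  norm_num [gaussianMoment_two]

theorem gaussianNorm_two : gaussianNorm 2 = 1 := by
  rw [gaussianNorm_eq two_pos, gaussianMoment_two, Real.one_rpow]

theorem lpNorm_le_of_exponent_le {Ω : Type*} [MeasurableSpace Ω] {μ : Measure Ω}
    [IsProbabilityMeasure μ] {f : Ω → ℝ} {p q : ℝ≥0∞} (hpq : p ≤ q) (hf : MemLp f q μ) :
    lpNorm f p μ ≤ lpNorm f q μ := by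
  rw [← toReal_eLpNorm hf.1, ← toReal_eLpNorm hf.1]
  exact ENNReal.toReal_mono hf.eLpNorm_ne_top (eLpNorm_le_eLpNorm_of_exponent_le hpq hf.1)

theorem gaussianNorm_mono {p q : ℝ} (hpq : p ≤ q) : gaussianNorm p ≤ gaussianNorm q :=
  lpNorm_le_of_exponent_le (ENNReal.ofReal_le_ofReal hpq) (memLp_id_gaussianReal' _ (by simp))

theorem one_le_gaussianNorm {p : ℝ} (hp : 2 ≤ p) : 1 ≤ gaussianNorm p :=
  gaussianNorm_two ▸ gaussianNorm_mono hp

theorem gaussianNorm_le_two {p : ℝ} (hp : p ≤ 4) : gaussianNorm p ≤ 2 := by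
  refine (gaussianNorm_mono hp).trans ?_
  rw [gaussianNorm_eq (by norm_num), gaussianMoment_four]
  calc (3:ℝ) ^ (4:ℝ)⁻¹ ≤ (16:ℝ) ^ (4:ℝ)⁻¹ := by gcongr; norm_num
    _ = ((2:ℝ) ^ (4:ℝ)) ^ (4:ℝ)⁻¹ := by norm_num
    _ = 2 := by rw [← Real.rpow_mul (by norm_num)]; norm_num

/-! ### Convexity of powers -/

theorem convexOn_abs_rpow {q : ℝ} (hq : 1 ≤ q) : ConvexOn ℝ Set.univ (fun x : ℝ => |x| ^ q) := by
  refine ⟨convex_univ, fun x _ y _ a b ha hb hab => ?_⟩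
  refine le_trans ?_ ((convexOn_rpow hq).2 (abs_nonneg x) (abs_nonneg y) ha hb hab)
  have : |a • x + b • y| ≤ a • |x| + b • |y| := by
    refine (abs_add_le _ _).trans ?_
    simp [abs_mul, abs_of_nonneg ha, abs_of_nonneg hb]
  exact Real.rpow_le_rpow (abs_nonneg _) this (by linarith)

/-- The points x ± u are convex combinations of x ± v with weights (v ± u)/(2v), interchanged
between the two points; the convexity inequalities add up. -/
theorem abs_add_rpow_add_abs_sub_rpow_le {q : ℝ} (hq : 1 ≤ q) (x : ℝ) {u v : ℝ} (hu : 0 ≤ u)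
    (huv : u ≤ v) : |x + u| ^ q + |x - u| ^ q ≤ |x + v| ^ q + |x - v| ^ q := by
  rcases eq_or_lt_of_le (hu.trans huv) with hv | hv
  · have : u = v := by linarith
    rw [this]
  · have hl : 0 ≤ (v + u) / (2 * v) := by positivity
    have hl' : 0 ≤ (v - u) / (2 * v) := div_nonneg (by linarith) (by linarith)
    have hs : (v + u) / (2 * v) + (v - u) / (2 * v) = 1 := by field_simp; ring
    have h1 := (convexOn_abs_rpow hq).2 (Set.mem_univ (x + v)) (Set.mem_univ (x - v)) hl hl' hs
    have h2 := (convexOn_abs_rpow hq).2 (Set.mem_univ (x + v)) (Set.mem_univ (x - v)) hl' hl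
      (by linarith)
    have e1 : ((v + u) / (2 * v)) • (x + v) + ((v - u) / (2 * v)) • (x - v) = x + u := by
      simp only [smul_eq_mul]; field_simp; ring
    have e2 : ((v - u) / (2 * v)) • (x + v) + ((v + u) / (2 * v)) • (x - v) = x - u := by
      simp only [smul_eq_mul]; field_simp; ring
    rw [e1] at h1
    rw [e2] at h2
    simp only [smul_eq_mul] at h1 h2
    linear_combination h1 + h2 + (|x + v| ^ q + |x - v| ^ q) * hs

theorem hasDerivAt_abs_rpow_mul_self {p : ℝ} (hp : 4 ≤ p) (x : ℝ) :
    HasDerivAt (fun x : ℝ => |x| ^ (p - 2) * x) ((p - 1) * |x| ^ (p - 2)) x := by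
  have h := (hasDerivAt_abs_rpow x (p := p - 2) (by linarith)).mul (hasDerivAt_id x)
  refine HasDerivAt.congr_deriv h ?_
  have : |x| ^ (p - 2) = |x| ^ (p - 2 - 2) * x ^ 2 := by
    rw [← sq_abs x, ← Real.rpow_two, ← Real.rpow_add_of_nonneg (abs_nonneg x) (by linarith) (by norm_num)]
    congr 1; ring
  simp only [id, mul_one, this]
  ring

theorem hasDerivAt_abs_rpow_mul_self_diff {p : ℝ} (hp : 4 ≤ p) (x u : ℝ) :
    HasDerivAt (fun u : ℝ => |x + u| ^ (p - 2) * (x + u) - |x - u| ^ (p - 2) * (x - u))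
      ((p - 1) * (|x + u| ^ (p - 2) + |x - u| ^ (p - 2))) u := by
  have h1 := (hasDerivAt_abs_rpow_mul_self hp (x + u)).comp u ((hasDerivAt_id u).const_add x)
  have h2 := (hasDerivAt_abs_rpow_mul_self hp (x - u)).comp u ((hasDerivAt_id u).const_sub x)
  refine HasDerivAt.congr_deriv (h1.sub h2) ?_
  ring

/-- A lower bound for the central difference of `x |x| ^ (p - 2)`. -/
theorem mul_abs_rpow_le_abs_rpow_mul_self_diff {p : ℝ} (hp : 4 ≤ p) (x : ℝ) {u : ℝ} (hu : 0 ≤ u) :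
    u * ((p - 1) * |x| ^ (p - 2))
      ≤ ((x + u) * |x + u| ^ (p - 2) - (x - u) * |x - u| ^ (p - 2)) / 2 := by
  have hd : ∀ v, HasDerivAt (fun u : ℝ => |x + u| ^ (p - 2) * (x + u) - |x - u| ^ (p - 2) * (x - u)
      - 2 * ((p - 1) * |x| ^ (p - 2)) * u)
      ((p - 1) * (|x + v| ^ (p - 2) + |x - v| ^ (p - 2)) - 2 * ((p - 1) * |x| ^ (p - 2))) v := by
    intro v
    have := (hasDerivAt_abs_rpow_mul_self_diff hp x v).sub
      ((hasDerivAt_id v).const_mul (2 * ((p - 1) * |x| ^ (p - 2))))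
    simpa using! this
  -- The difference of the two sides vanishes at u = 0, and its derivative is nonnegative by
  -- midpoint convexity of |·|^(p-2).
  have hm := monotone_of_deriv_nonneg (fun v => (hd v).differentiableAt) (fun v => by
    rw [(hd v).deriv]
    have := abs_rpow_midpoint_le (p := p - 2) (by linarith) x v
    nlinarith)
  have := hm hu
  simp at this
  linarith

/-- For fixed `x`, `u ↦ (|x + √u| ^ p + |x - √u| ^ p) / 2` has a supporting line at each point. -/
theorem exists_tangent_abs_rpow {p : ℝ} (hp : 4 ≤ p) (x : ℝ) {a : ℝ} (ha : 0 < a) :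
    ∃ m : ℝ, ∀ u, (|x + a| ^ p + |x - a| ^ p) / 2 + m * (u ^ 2 - a ^ 2)
      ≤ (|x + u| ^ p + |x - u| ^ p) / 2 := by
  set w : ℝ → ℝ := fun u => |x + u| ^ (p - 2) * (x + u) - |x - u| ^ (p - 2) * (x - u) with hw
  have hwd := hasDerivAt_abs_rpow_mul_self_diff hp x
  have hwdiff : Differentiable ℝ w := fun u => (hwd u).differentiableAt
  -- Convexity of w with w(0) = 0 makes w(u)/u nondecreasing. Up to a constant this quotient is the
  -- derivative of the even average with respect to u².
  have hconv : ConvexOn ℝ (Set.Ici 0) w := by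
    refine MonotoneOn.convexOn_of_deriv (convex_Ici 0) hwdiff.continuous.continuousOn
      hwdiff.differentiableOn ?_
    intro u hu v hv huv
    rw [interior_Ici] at hu
    rw [(hwd u).deriv, (hwd v).deriv]
    exact mul_le_mul_of_nonneg_left
      (abs_add_rpow_add_abs_sub_rpow_le (by linarith) x (le_of_lt hu) huv) (by linarith)
  have hw0 : w 0 = 0 := by simp [hw]
  have hstar : ∀ u v, 0 ≤ u → u ≤ v → 0 < v → w u ≤ u / v * w v := by
    intro u v hu huv hv
    have h := hconv.2 (Set.mem_Ici.2 hv.le) (Set.mem_Ici.2 le_rfl) (div_nonneg hu hv.le)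
      (sub_nonneg.2 ((div_le_one hv).2 huv)) (by ring)
    simp only [smul_eq_mul, hw0, mul_zero, add_zero] at h
    rwa [div_mul_cancel₀ _ hv.ne'] at h
  -- The slope in u² for which D has a critical point at a.
  set m : ℝ := p * w a / (4 * a) with hm
  set D : ℝ → ℝ := fun u => (|x + u| ^ p + |x - u| ^ p) / 2 - m * u ^ 2 with hD
  have hDd : ∀ u, HasDerivAt D (p / 2 * (w u - u / a * w a)) u := by
    intro u
    have h1 := (hasDerivAt_abs_rpow (x + u) (p := p) (by linarith)).comp u
      ((hasDerivAt_id u).const_add x)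
    have h2 := (hasDerivAt_abs_rpow (x - u) (p := p) (by linarith)).comp u
      ((hasDerivAt_id u).const_sub x)
    have h3 := ((h1.add h2).div_const 2).sub ((hasDerivAt_pow 2 u).const_mul m)
    refine HasDerivAt.congr_deriv h3 ?_
    simp only [hm, hw]
    field_simp
    push_cast
    ring
  have hDdiff : Differentiable ℝ D := fun u => (hDd u).differentiableAt
  have key : ∀ u, 0 ≤ u → D a ≤ D u := by
    intro u hu
    rcases le_total u a with hua | hua
    · have : AntitoneOn D (Set.Icc 0 a) := by
        refine antitoneOn_of_deriv_nonpos (convex_Icc 0 a) hDdiff.continuous.continuousOn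
          hDdiff.differentiableOn fun v hv => ?_
        rw [interior_Icc] at hv
        rw [(hDd v).deriv]
        have := hstar v a hv.1.le hv.2.le ha
        exact mul_nonpos_of_nonneg_of_nonpos (by linarith) (by linarith)
      exact this ⟨hu, hua⟩ ⟨ha.le, le_rfl⟩ hua
    · have : MonotoneOn D (Set.Ici a) := by
        refine monotoneOn_of_deriv_nonneg (convex_Ici a) hDdiff.continuous.continuousOn
          hDdiff.differentiableOn fun v hv => ?_
        rw [interior_Ici] at hv
        have hv' : a < v := hv
        rw [(hDd v).deriv]
        have h := hstar a v ha.le hv'.le (ha.trans hv')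
        have h2 : v / a * w a ≤ v / a * (a / v * w v) :=
          mul_le_mul_of_nonneg_left h (div_nonneg (ha.trans hv').le ha.le)
        have h3 : v / a * (a / v * w v) = w v := by
          have := (ha.trans hv').ne'
          field_simp
        exact mul_nonneg (by linarith) (by linarith)
      exact this (Set.mem_Ici.2 le_rfl) hua hua
  refine ⟨m, fun u => ?_⟩
  have h := key |u| (abs_nonneg u)
  have e : D |u| = D u := by
    rcases abs_choice u with h | h <;> rw [h]
    simp only [hD, ← sub_eq_add_neg, sub_neg_eq_add, neg_sq]
    rw [add_comm (|x - u| ^ p)]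
  rw [e] at h
  simp only [hD] at h
  linarith

theorem measurable_abs_rpow (p : ℝ) : Measurable (fun y : ℝ => |y| ^ p) :=
  measurable_norm.pow_const p

/-! ### Replacing signs by Gaussians -/

theorem integrable_abs_rpow_gaussianReal {p : ℝ} (hp : 0 < p) (m : ℝ) (v : ℝ≥0) :
    Integrable (fun y => |y| ^ p) (gaussianReal m v) := by
  have h := (memLp_id_gaussianReal' (μ := m) (v := v) (ENNReal.ofReal p) (by simp)).integrable_norm_rpow
    (by simpa using hp) (by simp)
  simpa [ENNReal.toReal_ofReal hp.le] using h

theorem integral_abs_rpow_gaussianReal_zero {p : ℝ} (v : ℝ≥0) :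
    ∫ y, |y| ^ p ∂gaussianReal 0 v = (v : ℝ) ^ (p / 2) * gaussianMoment p := by
  have h := gaussianReal_map_const_mul (μ := 0) (v := 1) (Real.sqrt v)
  have e : NNReal.mk (Real.sqrt v ^ 2) (sq_nonneg _) * 1 = v := by
    ext; simp
  rw [mul_zero] at h
  have h' : (gaussianReal 0 1).map (fun y => Real.sqrt v * y) = gaussianReal 0 v := h.trans (by rw [e])
  rw [← h', integral_map (by fun_prop) (measurable_abs_rpow p).aestronglyMeasurable, gaussianMoment, ← integral_const_mul]
  refine integral_congr_ae (Filter.Eventually.of_forall fun x => ?_)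
  simp only [abs_mul]
  rw [Real.mul_rpow (abs_nonneg _) (abs_nonneg _), abs_of_nonneg (Real.sqrt_nonneg _),
    Real.sqrt_eq_rpow, ← Real.rpow_mul v.coe_nonneg]
  congr 2; ring

theorem integral_comp_add_gaussianReal (f : ℝ → ℝ) (hf : Measurable f) (m c : ℝ) (v : ℝ≥0) :
    ∫ y, f (y + c) ∂gaussianReal m v = ∫ y, f y ∂gaussianReal (m + c) v := by
  rw [← gaussianReal_map_add_const, integral_map (by fun_prop) (by fun_prop)]

theorem integral_sq_gaussianReal_zero (v : ℝ≥0) : ∫ y, y ^ 2 ∂gaussianReal 0 v = v := by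
  have h := variance_fun_id_gaussianReal (μ := 0) (v := v)
  rw [variance_eq_integral (by fun_prop)] at h
  simpa [integral_id_gaussianReal] using h

theorem integrable_abs_add_rpow_gaussianReal {p : ℝ} (hp : 0 < p) (m c : ℝ) (v : ℝ≥0) :
    Integrable (fun y => |c + y| ^ p) (gaussianReal m v) := by
  have h := integrable_abs_rpow_gaussianReal hp (m + c) v
  rw [← gaussianReal_map_add_const, integrable_map_measure
    (measurable_abs_rpow p).aestronglyMeasurable (by fun_prop)] at h
  simpa [Function.comp_def, add_comm] using h

/-- Integrate the supporting line at a² over z of variance a²: the linear term has mean zero, and z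
is symmetric. -/
theorem abs_rpow_midpoint_le_integral_gaussianReal {p : ℝ} (hp : 4 ≤ p) (x a : ℝ) :
    (|x + a| ^ p + |x - a| ^ p) / 2 ≤ ∫ z, |x + z| ^ p ∂gaussianReal 0 (‖a‖₊ ^ 2) := by
  have hp0 : 0 < p := by linarith
  wlog ha : 0 < a generalizing a
  · rcases eq_or_lt_of_le (not_lt.1 ha) with h | h
    · simp [h]
    · have := this (-a) (by linarith)
      rw [nnnorm_neg, ← sub_eq_add_neg, sub_neg_eq_add] at this
      linarith
  obtain ⟨m, hm⟩ := exists_tangent_abs_rpow hp x ha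
  set ν := gaussianReal 0 (‖a‖₊ ^ 2)
  have hmeas : Measurable fun z : ℝ => |x + z| ^ p :=
    (measurable_abs_rpow p).comp (measurable_const_add x)
  have hi1 : Integrable (fun z => |x + z| ^ p) ν := integrable_abs_add_rpow_gaussianReal hp0 0 x _
  have hneg : ν.map (fun z => -z) = ν := by
    simp only [ν]; rw [gaussianReal_map_neg, neg_zero]
  have hi2 : Integrable (fun z => |x - z| ^ p) ν := by
    have h := hi1
    rw [← hneg, integrable_map_measure hmeas.aestronglyMeasurable (by fun_prop)] at h
    simpa [Function.comp_def, ← sub_eq_add_neg] using h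
  have e2 : ∫ z, |x - z| ^ p ∂ν = ∫ z, |x + z| ^ p ∂ν := by
    conv_rhs => rw [← hneg]
    rw [integral_map (by fun_prop) hmeas.aestronglyMeasurable]
    simp [← sub_eq_add_neg]
  have hsq : Integrable (fun z : ℝ => z ^ 2) ν :=
    (memLp_id_gaussianReal' (μ := 0) (v := ‖a‖₊ ^ 2) 2 (by simp)).integrable_sq
  have hv : ∫ z, z ^ 2 ∂ν = a ^ 2 := by
    rw [integral_sq_gaussianReal_zero]; simp
  have hlin : Integrable (fun z : ℝ => m * (z ^ 2 - a ^ 2)) ν :=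
    (hsq.sub (integrable_const _)).const_mul m
  have hle := integral_mono ((integrable_const _).add hlin) ((hi1.add hi2).div_const 2) hm
  simp only [Pi.add_apply] at hle
  rw [integral_add (integrable_const _) hlin,
    integral_const_mul, integral_sub hsq (integrable_const _), hv] at hle
  simp only [integral_const, probReal_univ, one_smul] at hle
  rw [integral_div, integral_add hi1 hi2, e2] at hle
  linarith

theorem integral_abs_rpow_gaussianReal_midpoint_le {p : ℝ} (hp : 4 ≤ p) (x a : ℝ) (v : ℝ≥0) :
    (∫ y, |y| ^ p ∂gaussianReal (x + a) v + ∫ y, |y| ^ p ∂gaussianReal (x - a) v) / 2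
      ≤ ∫ y, |y| ^ p ∂gaussianReal x (v + ‖a‖₊ ^ 2) := by
  have hp0 : 0 < p := by linarith
  have hconv := gaussianReal_conv_gaussianReal (m₁ := x) (m₂ := 0) (v₁ := v) (v₂ := ‖a‖₊ ^ 2)
  rw [add_zero] at hconv
  have hint : Integrable (fun y => |y| ^ p) (gaussianReal x v ∗ gaussianReal 0 (‖a‖₊ ^ 2)) := by
    rw [hconv]; exact integrable_abs_rpow_gaussianReal hp0 _ _
  have hint2 := ((integrable_conv_iff (measurable_abs_rpow p).aestronglyMeasurable).1 hint).2
  have hnorm : ∀ y : ℝ, ‖|y| ^ p‖ = |y| ^ p := fun y => Real.norm_of_nonneg (by positivity)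
  simp only [hnorm] at hint2
  have i1 : Integrable (fun y => |y + a| ^ p) (gaussianReal x v) := by
    simpa [add_comm] using integrable_abs_add_rpow_gaussianReal hp0 x a v
  have i2 : Integrable (fun y => |y - a| ^ p) (gaussianReal x v) := by
    simpa [add_comm, ← sub_eq_add_neg] using integrable_abs_add_rpow_gaussianReal hp0 x (-a) v
  rw [← hconv, integral_conv hint, sub_eq_add_neg,
    ← integral_comp_add_gaussianReal (fun y => |y| ^ p) (measurable_abs_rpow p),
    ← integral_comp_add_gaussianReal (fun y => |y| ^ p) (measurable_abs_rpow p)]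
  simp only [← sub_eq_add_neg]
  rw [← integral_add i1 i2, ← integral_div]
  exact integral_mono ((i1.add i2).div_const 2) hint2
    fun y => abs_rpow_midpoint_le_integral_gaussianReal hp y a

/-- Signs are exchanged one at a time, each adding its a_i² to the variance of the smoothing
Gaussian; hence the induction needs every v. -/
theorem radMean_integral_abs_rpow_gaussianReal_le {ι : Type*} [DecidableEq ι] (a : ι → ℝ)
    (s : Finset ι) {p : ℝ} (hp : 4 ≤ p) (v : ℝ≥0) :
    radMean a s (fun x => ∫ y, |y| ^ p ∂gaussianReal x v)
      ≤ ∫ y, |y| ^ p ∂gaussianReal 0 (v + ∑ i ∈ s, ‖a i‖₊ ^ 2) := by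
  induction s using Finset.induction_on generalizing v with
  | empty => simp
  | insert i s hi ih =>
    rw [radMean_insert hi, Finset.sum_insert hi, ← add_assoc, ← radMean_add, div_eq_mul_inv,
      ← radMean_mul_const]
    refine (radMean_mono fun x => ?_).trans (ih (v + ‖a i‖₊ ^ 2))
    rw [← div_eq_mul_inv]
    exact integral_abs_rpow_gaussianReal_midpoint_le hp x (a i) v

/-- Khintchine's inequality with the optimal constant, for exponents at least `4`. -/
theorem radMean_abs_rpow_le {ι : Type*} [DecidableEq ι] (a : ι → ℝ)
    (s : Finset ι) {p : ℝ} (hp : 4 ≤ p) :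
    radMean a s (fun x => |x| ^ p) ≤ (∑ i ∈ s, a i ^ 2) ^ (p / 2) * gaussianMoment p := by
  have h := radMean_integral_abs_rpow_gaussianReal_le a s hp 0
  rw [integral_abs_rpow_gaussianReal_zero] at h
  simpa [gaussianReal_zero_var] using h

/-! ### Comparison of products of cosines with Gaussians -/

/-- The function cos y · exp(y²/2) decreases because y ≤ tan y. -/
theorem cos_le_exp_neg_sq_div_two {x : ℝ} (h0 : 0 ≤ x) (h1 : x ≤ Real.pi / 2) :
    Real.cos x ≤ Real.exp (-x ^ 2 / 2) := by
  have hd : ∀ y, HasDerivAt (fun y => Real.cos y * Real.exp (y ^ 2 / 2))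
      (Real.exp (y ^ 2 / 2) * (y * Real.cos y - Real.sin y)) y := by
    intro y
    have h := (Real.hasDerivAt_cos y).mul (((hasDerivAt_pow 2 y).div_const 2).exp)
    refine HasDerivAt.congr_deriv h ?_
    push_cast; ring
  have hanti : AntitoneOn (fun y => Real.cos y * Real.exp (y ^ 2 / 2)) (Set.Icc 0 (Real.pi / 2)) := by
    refine antitoneOn_of_deriv_nonpos (convex_Icc _ _)
      (fun y _ => (hd y).continuousAt.continuousWithinAt)
      (fun y _ => (hd y).differentiableAt.differentiableWithinAt) fun y hy => ?_
    rw [interior_Icc] at hy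
    rw [(hd y).deriv]
    have hc : 0 < Real.cos y := Real.cos_pos_of_mem_Ioo ⟨by linarith [hy.1], hy.2⟩
    have := Real.lt_tan hy.1 hy.2
    rw [Real.tan_eq_sin_div_cos, lt_div_iff₀ hc] at this
    exact mul_nonpos_of_nonneg_of_nonpos (Real.exp_pos _).le (by linarith)
  have h := hanti ⟨le_rfl, by positivity⟩ ⟨h0, h1⟩ h0
  simp only [Real.cos_zero, one_mul] at h
  rw [show -x ^ 2 / 2 = -(x ^ 2 / 2) by ring, Real.exp_neg, ← one_div,
    le_div_iff₀ (Real.exp_pos _)]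
  simpa using h

theorem abs_prod_cos_le_one {ι : Type*} (s : Finset ι) (x : ι → ℝ) : |∏ i ∈ s, Real.cos (x i)| ≤ 1 := by
  rw [Finset.abs_prod]
  exact Finset.prod_le_one (fun _ _ => abs_nonneg _) fun _ _ => Real.abs_cos_le_one _

section
variable {ι : Type*} [DecidableEq ι] {s : Finset ι} {x : ι → ℝ} {y : ℝ}

/-- Inserting a factor w = cos x_i, with e = exp(-x_i²/2), leaves cos y (1 - w) ≤ 1 - e to prove. It
follows from cos y ≤ w ≤ e, 1 - w ≤ x_i²/2 and e(1 + x_i²/2) ≤ 1. -/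
theorem exp_sub_cos_mul_prod_cos_le (hy : y ≤ Real.pi / 2) (h0 : ∀ i ∈ s, 0 ≤ x i)
    (h1 : ∀ i ∈ s, x i ≤ y) (hy0 : 0 ≤ y) :
    Real.exp (-(∑ i ∈ s, x i ^ 2) / 2) - Real.cos y * ∏ i ∈ s, Real.cos (x i)
      ≤ 1 - Real.cos y := by
  induction s using Finset.induction_on with
  | empty => simp
  | insert i s hi ih =>
    simp only [Finset.mem_insert, forall_eq_or_imp] at h0 h1
    rw [Finset.sum_insert hi, Finset.prod_insert hi]
    have ih := ih h0.2 h1.2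
    set E := Real.exp (-(∑ i ∈ s, x i ^ 2) / 2)
    set P := ∏ i ∈ s, Real.cos (x i)
    have hP1 : P ≤ 1 := Finset.prod_le_one
      (fun j hj => Real.cos_nonneg_of_neg_pi_div_two_le_of_le
        (by linarith [h0.2 j hj, Real.pi_pos]) ((h1.2 j hj).trans hy))
      fun j _ => Real.cos_le_one _
    have hc : 0 ≤ Real.cos y := Real.cos_nonneg_of_neg_pi_div_two_le_of_le
        (by linarith [Real.pi_pos]) hy
    have hle : Real.cos y ≤ Real.cos (x i) :=
      Real.cos_le_cos_of_nonneg_of_le_pi h0.1 (by linarith [Real.pi_pos]) h1.1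
    have he := cos_le_exp_neg_sq_div_two h0.1 (h1.1.trans hy)
    have hsplit : Real.exp (-(x i ^ 2 + ∑ j ∈ s, x j ^ 2) / 2) = Real.exp (-x i ^ 2 / 2) * E := by
      rw [← Real.exp_add]; congr 1; ring
    rw [hsplit]
    have hepos := Real.exp_pos (-x i ^ 2 / 2)
    have hle1 := Real.one_sub_sq_div_two_le_cos (x := x i)
    have hexp : Real.exp (-x i ^ 2 / 2) * (1 + x i ^ 2 / 2) ≤ 1 := by
      have := Real.add_one_le_exp (x i ^ 2 / 2)
      rw [show -x i ^ 2 / 2 = -(x i ^ 2 / 2) by ring, Real.exp_neg,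
        inv_mul_le_iff₀ (Real.exp_pos _)]
      linarith
    set e := Real.exp (-x i ^ 2 / 2)
    set w := Real.cos (x i)
    have s1 : e * (E - Real.cos y * P) ≤ e * (1 - Real.cos y) :=
      mul_le_mul_of_nonneg_left ih hepos.le
    have s2 : Real.cos y * (e - w) * P ≤ Real.cos y * (e - w) :=
      mul_le_of_le_one_right (mul_nonneg hc (by linarith)) hP1
    have hw1 : w ≤ 1 := Real.cos_le_one _
    have s3 : Real.cos y * (1 - w) ≤ e * (x i ^ 2 / 2) :=
      mul_le_mul (hle.trans he) (by linarith) (by linarith) hepos.le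
    nlinarith

theorem exp_le_cos_mul_prod_cos_add (h0 : ∀ i ∈ s, 0 ≤ x i)
    (h1 : ∀ i ∈ s, x i ≤ y) (hy0 : 0 ≤ y) :
    Real.exp (-(∑ i ∈ s, x i ^ 2) / 2)
      ≤ Real.cos y * ∏ i ∈ s, Real.cos (x i) + y ^ 2 / 2 := by
  have hcy := Real.one_sub_sq_div_two_le_cos (x := y)
  rcases le_or_gt y (Real.pi / 2) with hy | hy
  · have := exp_sub_cos_mul_prod_cos_le hy h0 h1 hy0
    linarith
  · have hE : Real.exp (-(∑ i ∈ s, x i ^ 2) / 2) ≤ 1 :=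
      Real.exp_le_one_iff.2 (by
        have := Finset.sum_nonneg fun i (_ : i ∈ s) => sq_nonneg (x i)
        linarith)
    have hP := abs_le.1 (abs_prod_cos_le_one s x)
    -- Up to 2 the cosine of y is nonpositive, so the product is at least cos y ≥ 1 - y²/2; beyond 2
    -- the term y²/2 exceeds 2 and absorbs everything.
    rcases le_or_gt y 2 with h2 | h2
    · have hc : Real.cos y ≤ 0 := Real.cos_nonpos_of_pi_div_two_le_of_le hy.le
        (by linarith [Real.pi_gt_three])
      nlinarith
    · have := Real.abs_cos_le_one y
      have h3 : |Real.cos y * ∏ i ∈ s, Real.cos (x i)| ≤ 1 := by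
        rw [abs_mul]
        exact mul_le_one₀ this (abs_nonneg _) (abs_prod_cos_le_one s x)
      have := (abs_le.1 h3).1
      nlinarith

end

/-- If y² ≤ 2 all angles are below π/2, the product is at most E = exp(-∑ x_i²/2), and E(1 -
exp(-y²/2)) ≤ y²/2. Otherwise the right side exceeds 1. -/
theorem prod_cos_le_exp_add {ι : Type*} {s : Finset ι} {x : ι → ℝ} {y : ℝ}
    (h0 : ∀ i ∈ s, 0 ≤ x i) (h1 : ∀ i ∈ s, x i ≤ y) (hy0 : 0 ≤ y) :
    ∏ i ∈ s, Real.cos (x i) ≤ Real.exp (-(∑ i ∈ s, x i ^ 2 + y ^ 2) / 2) + y ^ 2 / 2 := by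
  have hP := abs_le.1 (abs_prod_cos_le_one s x)
  rcases le_or_gt (y ^ 2 / 2) 1 with hy | hy
  · have hy2 : y ≤ Real.pi / 2 := by nlinarith [Real.pi_gt_three]
    have hE : Real.exp (-(∑ i ∈ s, x i ^ 2) / 2) ≤ 1 :=
      Real.exp_le_one_iff.2 (by
        have := Finset.sum_nonneg fun i (_ : i ∈ s) => sq_nonneg (x i)
        linarith)
    have h : ∏ i ∈ s, Real.cos (x i) ≤ Real.exp (-(∑ i ∈ s, x i ^ 2) / 2) := by
      rw [neg_div, Finset.sum_div, ← Finset.sum_neg_distrib, Real.exp_sum]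
      refine Finset.prod_le_prod (fun j hj => Real.cos_nonneg_of_neg_pi_div_two_le_of_le
        (by linarith [h0 j hj, Real.pi_pos]) ((h1 j hj).trans hy2)) fun j hj => ?_
      rw [← neg_div]
      exact cos_le_exp_neg_sq_div_two (h0 j hj) ((h1 j hj).trans hy2)
    have e : Real.exp (-(∑ i ∈ s, x i ^ 2 + y ^ 2) / 2)
        = Real.exp (-(∑ i ∈ s, x i ^ 2) / 2) * Real.exp (-(y ^ 2 / 2)) := by
      rw [← Real.exp_add]; congr 1; ring
    rw [e]
    have := Real.one_sub_le_exp_neg (y ^ 2 / 2)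
    have hpos := Real.exp_pos (-(∑ i ∈ s, x i ^ 2) / 2)
    nlinarith [sq_nonneg y]
  · have := Real.exp_pos (-(∑ i ∈ s, x i ^ 2 + y ^ 2) / 2)
    linarith

/-! ### An integral representation of `|x| ^ p` for `2 < p < 4` -/

/-- `∫ t in (0, ∞), (cos t - 1 + t ^ 2 / 2) t ^ (-p - 1)`. -/
noncomputable def cosMoment (p : ℝ) : ℝ :=
  ∫ t in Set.Ioi (0:ℝ), (Real.cos t - 1 + t ^ 2 / 2) * t ^ (-p - 1)

section
variable {p : ℝ}

/-- The first factor is O(t⁴) at 0, which needs p < 4, and O(t²) at infinity, which needs p > 2. -/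
theorem integrableOn_cos_kernel (hp : 2 < p) (hp4 : p < 4) :
    IntegrableOn (fun t : ℝ => (Real.cos t - 1 + t ^ 2 / 2) * t ^ (-p - 1)) (Set.Ioi 0) := by
  rw [← Set.Ioc_union_Ioi_eq_Ioi zero_le_one]
  refine IntegrableOn.union ?_ ?_
  · have h : IntegrableOn (fun t : ℝ => t ^ (3 - p)) (Set.Ioc 0 1) :=
      (intervalIntegrable_iff_integrableOn_Ioc_of_le zero_le_one).1
        (intervalIntegral.intervalIntegrable_rpow' (by linarith))
    refine Integrable.mono' h (by fun_prop) ?_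
    refine (ae_restrict_iff' measurableSet_Ioc).2 (Filter.Eventually.of_forall fun t ht => ?_)
    have h1 := abs_le.1 (Real.cos_bound (x := t) (by rw [abs_of_pos ht.1]; exact ht.2))
    have h2 := Real.one_sub_sq_div_two_le_cos (x := t)
    rw [abs_of_pos ht.1] at h1
    have hpos := Real.rpow_pos_of_pos ht.1 (-p - 1)
    rw [Real.norm_of_nonneg (mul_nonneg (by linarith) hpos.le),
      show 3 - p = (4:ℕ) + (-p - 1) by push_cast; ring, Real.rpow_add ht.1, Real.rpow_natCast]
    refine mul_le_mul_of_nonneg_right ?_ hpos.le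
    have : 0 < t ^ 4 := pow_pos ht.1 4
    linarith [h1.2]
  · have h : IntegrableOn (fun t : ℝ => t ^ (1 - p)) (Set.Ioi 1) :=
      integrableOn_Ioi_rpow_of_lt (by linarith) one_pos
    refine Integrable.mono' h (by fun_prop) ?_
    refine (ae_restrict_iff' measurableSet_Ioi).2 (Filter.Eventually.of_forall fun t ht => ?_)
    have ht0 : 0 < t := one_pos.trans ht
    have h2 := Real.one_sub_sq_div_two_le_cos (x := t)
    have hpos := Real.rpow_pos_of_pos ht0 (-p - 1)
    rw [Real.norm_of_nonneg (mul_nonneg (by linarith) hpos.le),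
      show 1 - p = (2:ℕ) + (-p - 1) by push_cast; ring, Real.rpow_add ht0, Real.rpow_natCast]
    refine mul_le_mul_of_nonneg_right ?_ hpos.le
    nlinarith [Real.cos_le_one t, sq_nonneg t]

theorem cosMoment_pos (hp : 2 < p) (hp4 : p < 4) : 0 < cosMoment p := by
  rw [cosMoment, setIntegral_pos_iff_support_of_nonneg_ae _ (integrableOn_cos_kernel hp hp4)]
  · refine lt_of_lt_of_le ?_ (measure_mono (s := Set.Ioi (2:ℝ)) fun t ht => ?_)
    · simp
    · have ht : 2 < t := ht
      refine ⟨?_, show (0:ℝ) < t by linarith⟩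
      have hpos := Real.rpow_pos_of_pos (show 0 < t by linarith) (-p - 1)
      refine (mul_pos ?_ hpos).ne'
      nlinarith [Real.neg_one_le_cos t]
  · refine (ae_restrict_iff' measurableSet_Ioi).2 (Filter.Eventually.of_forall fun t ht => ?_)
    have h2 := Real.one_sub_sq_div_two_le_cos (x := t)
    exact mul_nonneg (by linarith) (Real.rpow_nonneg (le_of_lt ht) _)

theorem cos_kernel_scaling {x t : ℝ} (hx : 0 < x) (ht : 0 < t) :
    (Real.cos (t * x) - 1 + (t * x) ^ 2 / 2) * t ^ (-p - 1)
      = x ^ (p + 1) * ((Real.cos (x * t) - 1 + (x * t) ^ 2 / 2) * (x * t) ^ (-p - 1)) := by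
  have : x ^ (p + 1) * x ^ (-p - 1) = 1 := by
    rw [← Real.rpow_add hx, show p + 1 + (-p - 1) = 0 by ring, Real.rpow_zero]
  rw [Real.mul_rpow hx.le ht.le, mul_comm t x]
  linear_combination (-(Real.cos (x * t) - 1 + (x * t) ^ 2 / 2) * t ^ (-p - 1)) * this

theorem integrableOn_cos_kernel_mul (hp : 2 < p) (hp4 : p < 4) (x : ℝ) :
    IntegrableOn (fun t : ℝ => (Real.cos (t * x) - 1 + (t * x) ^ 2 / 2) * t ^ (-p - 1))
      (Set.Ioi 0) := by
  wlog hx : 0 < x generalizing x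
  · rcases eq_or_lt_of_le (not_lt.1 hx) with h | h
    · simp [h]
    · simpa using this (-x) (by linarith)
  have h := (integrableOn_Ioi_comp_mul_left_iff
    (fun t : ℝ => (Real.cos t - 1 + t ^ 2 / 2) * t ^ (-p - 1)) 0 hx).2
    (by simpa using integrableOn_cos_kernel hp hp4)
  exact IntegrableOn.congr_fun (h.const_mul (x ^ (p + 1)))
    (fun t ht => (cos_kernel_scaling hx ht).symm) measurableSet_Ioi

theorem integral_cos_kernel_mul (hp : 2 < p) (x : ℝ) :
    ∫ t in Set.Ioi (0:ℝ), (Real.cos (t * x) - 1 + (t * x) ^ 2 / 2) * t ^ (-p - 1)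
      = |x| ^ p * cosMoment p := by
  wlog hx : 0 < x generalizing x
  · rcases eq_or_lt_of_le (not_lt.1 hx) with h | h
    · simp [h, Real.zero_rpow (show p ≠ 0 by linarith)]
    · simpa using this (-x) (by linarith)
  rw [setIntegral_congr_fun measurableSet_Ioi fun t ht => cos_kernel_scaling hx ht,
    integral_const_mul, integral_comp_mul_left_Ioi
      (fun t : ℝ => (Real.cos t - 1 + t ^ 2 / 2) * t ^ (-p - 1)) 0 hx, mul_zero, ← cosMoment,
    abs_of_pos hx, smul_eq_mul, ← mul_assoc, Real.rpow_add hx, Real.rpow_one,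
    mul_inv_cancel_right₀ hx.ne']

theorem integral_cos_gaussianReal_zero (v : ℝ≥0) (t : ℝ) :
    ∫ y, Real.cos (t * y) ∂gaussianReal 0 v = Real.exp (-(v * t ^ 2) / 2) := by
  have h := charFun_gaussianReal (μ := 0) (v := v) t
  rw [charFun_apply_real] at h
  have hi : Integrable (fun y : ℝ => Complex.exp (t * y * Complex.I)) (gaussianReal 0 v) := by
    refine Integrable.of_bound (by fun_prop) 1 (Filter.Eventually.of_forall fun y => ?_)
    rw [← Complex.ofReal_mul, Complex.norm_exp_ofReal_mul_I]
  have h2 := Complex.reCLM.integral_comp_comm hi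
  rw [h] at h2
  simp only [Complex.reCLM_apply, ← Complex.ofReal_mul, Complex.exp_ofReal_mul_I_re] at h2
  rw [h2]
  have : (t * (0:ℝ) * Complex.I - v * t ^ 2 / 2 : ℂ) = ((-(v * t ^ 2) / 2 : ℝ) : ℂ) := by
    push_cast; ring
  simp only [Complex.ofReal_zero, mul_zero, zero_mul] at this ⊢
  rw [this, Complex.exp_ofReal_re]

theorem integral_cos_kernel_gaussianReal (v : ℝ≥0) (t : ℝ) :
    ∫ y, (Real.cos (t * y) - 1 + (t * y) ^ 2 / 2) * t ^ (-p - 1) ∂gaussianReal 0 v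
      = (Real.exp (-(v * t ^ 2) / 2) - 1 + v * t ^ 2 / 2) * t ^ (-p - 1) := by
  have hsq : Integrable (fun z : ℝ => z ^ 2) (gaussianReal 0 v) :=
    (memLp_id_gaussianReal' (μ := 0) (v := v) 2 (by simp)).integrable_sq
  have hc : Integrable (fun y : ℝ => Real.cos (t * y)) (gaussianReal 0 v) :=
    Integrable.of_bound (by fun_prop) 1 (Filter.Eventually.of_forall fun y => Real.abs_cos_le_one _)
  have hq : Integrable (fun y : ℝ => (t * y) ^ 2 / 2) (gaussianReal 0 v) := by
    simp only [mul_pow]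
    exact (hsq.const_mul _).div_const 2
  have hc1 : Integrable (fun y : ℝ => Real.cos (t * y) - 1) (gaussianReal 0 v) :=
    hc.sub (integrable_const 1)
  rw [integral_mul_const, integral_add hc1 hq, integral_sub hc (integrable_const 1), integral_cos_gaussianReal_zero]
  congr 1
  simp only [mul_pow, integral_div, integral_const_mul, integral_sq_gaussianReal_zero]
  simp [mul_comm]

/-- The kernel is nonnegative and its t-integral is a multiple of |y|^p, so Gaussian moments give
joint integrability. -/
theorem integrable_prod_cos_kernel (hp : 2 < p) (hp4 : p < 4) (v : ℝ≥0) :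
    Integrable (Function.uncurry fun y t : ℝ =>
      (Real.cos (t * y) - 1 + (t * y) ^ 2 / 2) * t ^ (-p - 1))
      ((gaussianReal 0 v).prod (volume.restrict (Set.Ioi 0))) := by
  have hmeas : Measurable (Function.uncurry fun y t : ℝ =>
      (Real.cos (t * y) - 1 + (t * y) ^ 2 / 2) * t ^ (-p - 1)) := by
    unfold Function.uncurry
    fun_prop
  refine (integrable_prod_iff hmeas.aestronglyMeasurable).2
    ⟨Filter.Eventually.of_forall fun y => integrableOn_cos_kernel_mul hp hp4 y, ?_⟩
  refine ((integrable_abs_rpow_gaussianReal (p := p) (by linarith) 0 v).mul_const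
    (cosMoment p)).congr (Filter.Eventually.of_forall fun y => ?_)
  simp only [Function.uncurry]
  rw [← integral_cos_kernel_mul hp]
  refine setIntegral_congr_fun measurableSet_Ioi fun t ht => ?_
  have h2 := Real.one_sub_sq_div_two_le_cos (x := t * y)
  exact (Real.norm_of_nonneg (mul_nonneg (by linarith) (Real.rpow_nonneg (le_of_lt ht) _))).symm

theorem integrableOn_exp_kernel (hp : 2 < p) (hp4 : p < 4) (v : ℝ≥0) :
    IntegrableOn (fun t : ℝ => (Real.exp (-(v * t ^ 2) / 2) - 1 + v * t ^ 2 / 2) * t ^ (-p - 1))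
      (Set.Ioi 0) := by
  have h := (integrable_prod_cos_kernel hp hp4 v).integral_prod_right
  simp only [Function.uncurry, integral_cos_kernel_gaussianReal] at h
  exact h

theorem integral_exp_kernel (hp : 2 < p) (hp4 : p < 4) (v : ℝ≥0) :
    ∫ t in Set.Ioi (0:ℝ), (Real.exp (-(v * t ^ 2) / 2) - 1 + v * t ^ 2 / 2) * t ^ (-p - 1)
      = (v : ℝ) ^ (p / 2) * gaussianMoment p * cosMoment p := by
  have h := integral_integral_swap (integrable_prod_cos_kernel hp hp4 v)
  simp only [integral_cos_kernel_gaussianReal] at h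
  simp only [integral_cos_kernel_mul hp, integral_mul_const] at h
  rw [← h, integral_abs_rpow_gaussianReal_zero]

/-! ### Comparison with Gaussians for 2 < p < 4 -/

section
variable {ι : Type*} [DecidableEq ι] {a : ι → ℝ} {s : Finset ι}

theorem radMean_cos_kernel (t : ℝ) :
    radMean a s (fun x => (Real.cos (t * x) - 1 + (t * x) ^ 2 / 2) * t ^ (-p - 1))
      = (∏ i ∈ s, Real.cos (t * a i) - 1 + (∑ i ∈ s, a i ^ 2) * t ^ 2 / 2) * t ^ (-p - 1) := by
  have e : (fun x => Real.cos (t * x) - 1 + (t * x) ^ 2 / 2)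
      = fun x => Real.cos (t * x) + -1 + x ^ 2 * (t ^ 2 / 2) := by
    funext x; ring
  rw [radMean_mul_const, e, radMean_add, radMean_add, radMean_const, radMean_cos, radMean_mul_const,
    radMean_sq]
  ring

theorem integrableOn_prod_cos_kernel (hp : 2 < p) (hp4 : p < 4) :
    IntegrableOn (fun t : ℝ => (∏ i ∈ s, Real.cos (t * a i) - 1
      + (∑ i ∈ s, a i ^ 2) * t ^ 2 / 2) * t ^ (-p - 1)) (Set.Ioi 0) := by
  simp only [← radMean_cos_kernel]
  exact (integrable_finsetSum _ fun u _ => integrableOn_cos_kernel_mul hp hp4 _).div_const _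

theorem integral_prod_cos_kernel (hp : 2 < p) (hp4 : p < 4) :
    ∫ t in Set.Ioi (0:ℝ), (∏ i ∈ s, Real.cos (t * a i) - 1
      + (∑ i ∈ s, a i ^ 2) * t ^ 2 / 2) * t ^ (-p - 1)
      = radMean a s (fun x => |x| ^ p) * cosMoment p := by
  simp only [← radMean_cos_kernel]
  rw [← radMean_mul_const]
  simp only [← integral_cos_kernel_mul hp]
  unfold radMean
  rw [integral_div, integral_finsetSum _ fun u _ => integrableOn_cos_kernel_mul hp hp4 _]

/-- The Gaussian variance omits a_j², while the quadratic term of the signed sum retains it; this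
surplus t²a_j²/2 is exactly the error in `exp_le_cos_mul_prod_cos_add`. -/
theorem le_radMean_of_lt_four (hp : 2 < p) (hp4 : p < 4) (h0 : ∀ i ∈ s, 0 ≤ a i) {j : ι}
    (hj : j ∈ s) (hmax : ∀ i ∈ s, a i ≤ a j) :
    (∑ i ∈ s.erase j, a i ^ 2) ^ (p / 2) * gaussianMoment p ≤ radMean a s (fun x => |x| ^ p) := by
  have hv0 : 0 ≤ ∑ i ∈ s.erase j, a i ^ 2 := Finset.sum_nonneg fun i _ => sq_nonneg _
  obtain ⟨v, hv⟩ : ∃ v : ℝ≥0, (v : ℝ) = ∑ i ∈ s.erase j, a i ^ 2 := ⟨⟨_, hv0⟩, rfl⟩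
  rw [← hv]
  refine le_of_mul_le_mul_right ?_ (cosMoment_pos hp hp4)
  rw [← integral_exp_kernel hp hp4, ← integral_prod_cos_kernel hp hp4]
  refine setIntegral_mono_on (integrableOn_exp_kernel hp hp4 v)
    (integrableOn_prod_cos_kernel hp hp4) measurableSet_Ioi fun t ht => ?_
  have ht : 0 < t := ht
  refine mul_le_mul_of_nonneg_right ?_ (Real.rpow_nonneg ht.le _)
  have h := exp_le_cos_mul_prod_cos_add (s := s.erase j) (x := fun i => t * a i) (y := t * a j)
    (fun i hi => mul_nonneg ht.le (h0 i (Finset.mem_of_mem_erase hi)))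
    (fun i hi => mul_le_mul_of_nonneg_left (hmax i (Finset.mem_of_mem_erase hi)) ht.le)
    (mul_nonneg ht.le (h0 j hj))
  rw [Finset.mul_prod_erase s (fun i => Real.cos (t * a i)) hj] at h
  simp only [mul_pow, ← Finset.mul_sum, ← hv] at h
  rw [← Finset.add_sum_erase s _ hj, ← hv, mul_comm (v : ℝ)]
  linarith

/-- Here the Gaussian has the surplus variance a_j², whose quadratic term pays for the error in
`prod_cos_le_exp_add`. -/
theorem radMean_le_of_lt_four (hp : 2 < p) (hp4 : p < 4) (h0 : ∀ i ∈ s, 0 ≤ a i) {j : ι}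
    (hj : j ∈ s) (hmax : ∀ i ∈ s, a i ≤ a j) :
    radMean a s (fun x => |x| ^ p)
      ≤ (∑ i ∈ s, a i ^ 2 + a j ^ 2) ^ (p / 2) * gaussianMoment p := by
  have hv0 : 0 ≤ ∑ i ∈ s, a i ^ 2 + a j ^ 2 :=
    add_nonneg (Finset.sum_nonneg fun i _ => sq_nonneg _) (sq_nonneg _)
  obtain ⟨v, hv⟩ : ∃ v : ℝ≥0, (v : ℝ) = ∑ i ∈ s, a i ^ 2 + a j ^ 2 := ⟨⟨_, hv0⟩, rfl⟩
  rw [← hv]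
  refine le_of_mul_le_mul_right ?_ (cosMoment_pos hp hp4)
  rw [← integral_exp_kernel hp hp4, ← integral_prod_cos_kernel hp hp4]
  refine setIntegral_mono_on (integrableOn_prod_cos_kernel hp hp4)
    (integrableOn_exp_kernel hp hp4 v) measurableSet_Ioi fun t ht => ?_
  have ht : 0 < t := ht
  refine mul_le_mul_of_nonneg_right ?_ (Real.rpow_nonneg ht.le _)
  have h := prod_cos_le_exp_add (s := s) (x := fun i => t * a i) (y := t * a j)
    (fun i hi => mul_nonneg ht.le (h0 i hi))
    (fun i hi => mul_le_mul_of_nonneg_left (hmax i hi) ht.le)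
    (mul_nonneg ht.le (h0 j hj))
  simp only [mul_pow, ← Finset.mul_sum, ← mul_add, ← hv] at h
  rw [mul_comm (v : ℝ), show ∑ i ∈ s, a i ^ 2 = v - a j ^ 2 by rw [hv]; ring]
  linarith

end

end

/-! ### Gaussian lower bound for all p ≥ 2 -/

section
variable {ι : Type*} [DecidableEq ι] {a : ι → ℝ} {s : Finset ι} {p : ℝ}

/-- If `v` bounds from below every sum of the `a i ^ 2` from which fewer than `p / 2` terms
are removed, then the `p`-th moment of the Rademacher sum is at least that of a centered Gaussian
of variance `v`. -/
theorem rpow_mul_gaussianMoment_le_radMean (hp : 2 ≤ p) (h0 : ∀ i ∈ s, 0 ≤ a i) {v : ℝ}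
    (hv : 0 ≤ v) (h : ∀ t ⊆ s, (t.card : ℝ) < p / 2 → v ≤ ∑ i ∈ s \ t, a i ^ 2) :
    v ^ (p / 2) * gaussianMoment p ≤ radMean a s (fun x => |x| ^ p) := by
  -- N serves only to make the descent from p to p - 2 terminate.
  obtain ⟨N, hN⟩ := exists_nat_gt p
  induction N generalizing p s with
  | zero => norm_num at hN; linarith
  | succ N ih =>
  rcases eq_or_lt_of_le hp with rfl | hp2
  · have h1 := h ∅ (by simp) (by norm_num)
    simpa [gaussianMoment_two, radMean_sq] using h1
  rcases lt_or_ge p 4 with hp4 | hp4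
  · rcases s.eq_empty_or_nonempty with rfl | hs
    · have hv' : v = 0 := le_antisymm (by simpa using h ∅ (by simp) (by simp; linarith)) hv
      rw [hv', Real.zero_rpow (by linarith), zero_mul]
      exact radMean_nonneg fun x => by positivity
    · obtain ⟨j, hj, hmax⟩ := s.exists_max_image a hs
      refine le_trans ?_ (le_radMean_of_lt_four hp2 hp4 h0 hj hmax)
      have h1 := h {j} (by simpa using hj) (by simp; linarith)
      rw [Finset.sdiff_singleton_eq_erase] at h1
      exact mul_le_mul_of_nonneg_right (Real.rpow_le_rpow hv h1 (by linarith))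
        (gaussianMoment_nonneg p)
  · have e : (fun x : ℝ => |x| ^ p) = fun x => x * (x * |x| ^ (p - 2)) := by
      funext x
      rw [← mul_assoc, ← sq, ← sq_abs, ← Real.rpow_two,
        ← Real.rpow_add_of_nonneg (abs_nonneg x) (by norm_num) (by linarith)]
      congr 1; ring
    have hterm : ∀ i ∈ s, a i ^ 2 * (v ^ ((p - 2) / 2) * gaussianMoment p)
        ≤ a i * radMean a (s.erase i) (fun x => ((x + a i) * |x + a i| ^ (p - 2)
          - (x - a i) * |x - a i| ^ (p - 2)) / 2) := by
      intro i hi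
      have hai := h0 i hi
      have h1 : radMean a (s.erase i) (fun x => |x| ^ (p - 2)) * (a i * (p - 1))
          ≤ radMean a (s.erase i) (fun x => ((x + a i) * |x + a i| ^ (p - 2)
          - (x - a i) * |x - a i| ^ (p - 2)) / 2) := by
        rw [← radMean_mul_const]
        refine radMean_mono fun x => ?_
        have := mul_abs_rpow_le_abs_rpow_mul_self_diff hp4 x hai
        linarith
      -- The hypothesis is inherited: adding i to a set of fewer than (p - 2)/2 indices gives one of
      -- fewer than p/2.
      have h2 := ih (p := p - 2) (s := s.erase i) (by linarith)
        (fun k hk => h0 k (Finset.mem_of_mem_erase hk)) (fun t ht hcard => by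
          have hit : i ∉ t := fun hit => Finset.notMem_erase i s (ht hit)
          have hsub : insert i t ⊆ s := Finset.insert_subset hi (ht.trans (Finset.erase_subset i s))
          have h3 := h (insert i t) hsub (by
            rw [Finset.card_insert_of_notMem hit]; push_cast; linarith)
          have e2 : s \ insert i t = s.erase i \ t := by
            ext k; simp only [Finset.mem_sdiff, Finset.mem_insert, Finset.mem_erase]; tauto
          rwa [e2] at h3) (by push_cast at hN; linarith)
      have h4 : v ^ ((p - 2) / 2) * gaussianMoment (p - 2) * (a i * (p - 1))
          ≤ radMean a (s.erase i) (fun x => |x| ^ (p - 2)) * (a i * (p - 1)) :=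
        mul_le_mul_of_nonneg_right h2 (mul_nonneg hai (by linarith))
      have h5 := mul_le_mul_of_nonneg_left (h4.trans h1) hai
      rw [gaussianMoment_eq_mul (by linarith)]
      refine le_trans (le_of_eq ?_) h5
      ring
    have hvs : v ≤ ∑ i ∈ s, a i ^ 2 := by simpa using h ∅ (by simp) (by simp; linarith)
    rw [e, radMean_id_mul]
    refine le_trans ?_ (Finset.sum_le_sum hterm)
    rw [← Finset.sum_mul, show p / 2 = 1 + (p - 2) / 2 by ring,
      Real.rpow_add_of_nonneg hv (by norm_num) (by linarith), Real.rpow_one, mul_assoc]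
    exact mul_le_mul_of_nonneg_right hvs
      (mul_nonneg (Real.rpow_nonneg hv _) (gaussianMoment_nonneg p))

theorem radMean_abs_rpow_le_rpow_sum (hp : 0 ≤ p) :
    radMean a s (fun x => |x| ^ p) ≤ (∑ i ∈ s, |a i|) ^ p := by
  unfold radMean
  rw [div_le_iff₀ (by positivity)]
  refine (Finset.sum_le_card_nsmul _ _ ((∑ i ∈ s, |a i|) ^ p) fun t ht => ?_).trans
    (le_of_eq (by simp [Finset.card_powerset, mul_comm]))
  refine Real.rpow_le_rpow (abs_nonneg _) ?_ hp
  rw [← Finset.sum_sdiff (Finset.mem_powerset.1 ht), add_comm]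
  exact (abs_sub _ _).trans
    (add_le_add (Finset.abs_sum_le_sum_abs _ _) (Finset.abs_sum_le_sum_abs _ _))

theorem rpow_mul_gaussianMoment_rpow_inv (hp : 0 < p) {v : ℝ} (hv : 0 ≤ v) :
    (v ^ (p / 2) * gaussianMoment p) ^ p⁻¹ = gaussianNorm p * Real.sqrt v := by
  rw [Real.mul_rpow (Real.rpow_nonneg hv _) (gaussianMoment_nonneg p), ← gaussianNorm_eq hp,
    ← Real.rpow_mul hv, Real.sqrt_eq_rpow, mul_comm]
  congr 2
  field_simp

end

/-! ### Upper bounds -/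

section
variable {Ω : Type*} [MeasurableSpace Ω] {μ : Measure Ω} [IsProbabilityMeasure μ]
  {ι : Type*} [DecidableEq ι] {ε : ι → Ω → ℝ} {p : ℝ}

theorem IsBernoulliFamily.lpNorm_le_lpNorm_sdiff_add (hε : IsBernoulliFamily μ ε) (a : ι → ℝ)
    {s t : Finset ι} (hts : t ⊆ s) (hp : 1 ≤ p) :
    lpNorm (fun ω => ∑ i ∈ s, a i * ε i ω) (ENNReal.ofReal p) μ
      ≤ lpNorm (fun ω => ∑ i ∈ s \ t, a i * ε i ω) (ENNReal.ofReal p) μ + ∑ i ∈ t, |a i| := by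
  have e : (fun ω => ∑ i ∈ s, a i * ε i ω)
      = (fun ω => ∑ i ∈ s \ t, a i * ε i ω) + fun ω => ∑ i ∈ t, a i * ε i ω := by
    funext ω; exact (Finset.sum_sdiff hts).symm
  have hp0 : 0 < p := by linarith
  rw [e]
  refine (lpNorm_add_le (hε.memLp a _ _) (by simpa using ENNReal.ofReal_le_ofReal hp)).trans ?_
  gcongr
  rw [hε.lpNorm_eq a t hp0]
  have h0 : 0 ≤ ∑ i ∈ t, |a i| := Finset.sum_nonneg fun i _ => abs_nonneg _
  refine (Real.rpow_le_rpow (radMean_nonneg fun x => by positivity)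
    (radMean_abs_rpow_le_rpow_sum hp0.le) (inv_nonneg.2 hp0.le)).trans (le_of_eq ?_)
  exact Real.rpow_rpow_inv h0 hp0.ne'

theorem IsBernoulliFamily.lpNorm_le_of_four_le (hε : IsBernoulliFamily μ ε) (a : ι → ℝ)
    {s t : Finset ι} (hts : t ⊆ s) (hp : 4 ≤ p) :
    lpNorm (fun ω => ∑ i ∈ s, a i * ε i ω) (ENNReal.ofReal p) μ
      ≤ gaussianNorm p * Real.sqrt (∑ i ∈ s \ t, a i ^ 2) + ∑ i ∈ t, |a i| := by
  have hp0 : 0 < p := by linarith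
  refine (hε.lpNorm_le_lpNorm_sdiff_add a hts (by linarith)).trans ?_
  gcongr
  rw [hε.lpNorm_eq a _ hp0, ← rpow_mul_gaussianMoment_rpow_inv hp0
    (Finset.sum_nonneg fun i _ => sq_nonneg _)]
  exact Real.rpow_le_rpow (radMean_nonneg fun x => by positivity)
    (radMean_abs_rpow_le a _ hp) (inv_nonneg.2 hp0.le)

theorem IsBernoulliFamily.lpNorm_le_of_lt_four (hε : IsBernoulliFamily μ ε) (a : ι → ℝ)
    {s : Finset ι} {j : ι} (hj : j ∈ s) (hmax : ∀ i ∈ s, |a i| ≤ |a j|)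
    (hp : 2 < p) (hp4 : p < 4) :
    lpNorm (fun ω => ∑ i ∈ s, a i * ε i ω) (ENNReal.ofReal p) μ
      ≤ gaussianNorm p * Real.sqrt (∑ i ∈ s.erase j, a i ^ 2) + |a j| := by
  have hp0 : 0 < p := by linarith
  set V := ∑ i ∈ s.erase j, a i ^ 2 with hV
  have hV0 : 0 ≤ V := Finset.sum_nonneg fun i _ => sq_nonneg _
  set τ := Real.sqrt V with hτ
  have hτ0 : 0 ≤ τ := Real.sqrt_nonneg _
  have hτV : τ ^ 2 = V := Real.sq_sqrt hV0
  set b := |a j| with hb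
  have hb0 : 0 ≤ b := abs_nonneg _
  have hbsq : a j ^ 2 = b ^ 2 := (sq_abs _).symm
  have hγ1 := one_le_gaussianNorm hp.le
  have hγ2 := gaussianNorm_le_two hp4.le
  set γ := gaussianNorm p
  -- For τ ≤ 2b, 3τ⁴ + 6τ²b² + b⁴ ≤ (τ + b)⁴ and γ ≥ 1. For τ ≥ 2b, γ²(τ² + 2b²) ≤ (γτ + b)²,
  -- because γ ≤ 2 gives 2γ²b² ≤ 2γτb.
  rcases le_total τ (2 * b) with hle | hle
  · refine (lpNorm_le_of_exponent_le (ENNReal.ofReal_le_ofReal hp4.le) (hε.memLp a s _)).trans ?_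
    rw [hε.lpNorm_eq a s (by norm_num)]
    have e : (fun x : ℝ => |x| ^ (4:ℝ)) = fun x => x ^ 4 := by
      funext x
      rw [show (4:ℝ) = ((4:ℕ):ℝ) by norm_num, Real.rpow_natCast, ← abs_pow]
      exact abs_of_nonneg (Even.pow_nonneg (by decide) x)
    have h4 : radMean a s (fun x => |x| ^ (4:ℝ)) ≤ (τ + b) ^ (4:ℝ) := by
      rw [e, ← Finset.insert_erase hj, radMean_insert_pow_four (Finset.notMem_erase j s), ← hV,
        show a j ^ 4 = (a j ^ 2) ^ 2 by ring, hbsq,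
        show (4:ℝ) = ((4:ℕ):ℝ) by norm_num, Real.rpow_natCast]
      have h := radMean_pow_four_le (a := a) (s := s.erase j)
      rw [← hV] at h
      rw [← hτV] at h ⊢
      have h1 : 0 ≤ τ ^ 3 * (2 * b - τ) := mul_nonneg (by positivity) (by linarith)
      have h2 : 0 ≤ b ^ 3 * τ := by positivity
      nlinarith
    refine (Real.rpow_le_rpow (radMean_nonneg fun x => by positivity) h4 (by norm_num)).trans ?_
    rw [Real.rpow_rpow_inv (by positivity) (by norm_num)]
    nlinarith
  · rw [hε.lpNorm_eq a s hp0, ← radMean_abs]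
    have h := radMean_le_of_lt_four (a := fun i => |a i|) hp hp4 (fun i _ => abs_nonneg _) hj hmax
    refine (Real.rpow_le_rpow (radMean_nonneg fun x => by positivity) h
      (inv_nonneg.2 hp0.le)).trans ?_
    simp only [sq_abs]
    rw [rpow_mul_gaussianMoment_rpow_inv hp0 (by positivity), ← Finset.add_sum_erase s _ hj, ← hV]
    have h1 : Real.sqrt (a j ^ 2 + V + a j ^ 2) ^ 2 = τ ^ 2 + 2 * b ^ 2 := by
      rw [Real.sq_sqrt (by positivity), hbsq, hτV]; ring
    refine abs_le_of_sq_le_sq' ?_ (by positivity) |>.2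
    rw [mul_pow, h1]
    have h2 : 0 ≤ γ * b * (τ - 2 * b) := mul_nonneg (by positivity) (by linarith)
    have h3 : 0 ≤ (2 - γ) * γ * b ^ 2 := by
      have : 0 ≤ 2 - γ := by linarith
      positivity
    nlinarith

end

/-! ### Rearrangement and conclusion -/

/-- An exchange argument: indices of t outside the head are no more numerous than head indices
missed by t, and `b c` separates their values. -/
theorem sum_tail_sq_le_sum_sdiff {n : ℕ} {b : Fin n → ℝ} (hb : Antitone b) (h0 : ∀ i, 0 ≤ b i)
    {k : ℕ} {t : Finset (Fin n)} (ht : t.card < k) :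
    ∑ i with k ≤ i.val + 1, b i ^ 2 ≤ ∑ i ∈ Finset.univ \ t, b i ^ 2 := by
  rcases lt_or_ge n k with hn | hn
  · rw [Finset.filter_false_of_mem (fun i _ => by have := i.2; omega), Finset.sum_empty]
    exact Finset.sum_nonneg fun i _ => sq_nonneg _
  · let c : Fin n := ⟨k - 1, by omega⟩
    have hS : (Finset.univ.filter fun i : Fin n => k ≤ i.val + 1) = Finset.univ \ Finset.Iio c := by
      ext i; simp [c, Fin.le_def]
    have hcard : t.card ≤ (Finset.Iio c).card := by
      rw [Fin.card_Iio]; simp only [c]; omega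
    have hsd : (t \ Finset.Iio c).card ≤ (Finset.Iio c \ t).card := by
      have h1 := Finset.card_sdiff_add_card_inter t (Finset.Iio c)
      have h2 := Finset.card_sdiff_add_card_inter (Finset.Iio c) t
      rw [Finset.inter_comm] at h2
      omega
    have h1 : ∑ i ∈ t \ Finset.Iio c, b i ^ 2 ≤ (t \ Finset.Iio c).card • b c ^ 2 :=
      Finset.sum_le_card_nsmul _ _ _ fun i hi => by
        have : c ≤ i := by simpa using (Finset.mem_sdiff.1 hi).2
        exact pow_le_pow_left₀ (h0 i) (hb this) 2
    have h2 : (Finset.Iio c \ t).card • b c ^ 2 ≤ ∑ i ∈ Finset.Iio c \ t, b i ^ 2 :=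
      Finset.card_nsmul_le_sum _ _ _ fun i hi => by
        have : i < c := by simpa using (Finset.mem_sdiff.1 hi).1
        exact pow_le_pow_left₀ (h0 c) (hb this.le) 2
    have h3 : (t \ Finset.Iio c).card • b c ^ 2 ≤ (Finset.Iio c \ t).card • b c ^ 2 :=
      nsmul_le_nsmul_left (sq_nonneg _) hsd
    rw [hS]
    have e1 := Finset.sum_sdiff (f := fun i => b i ^ 2) (Finset.subset_univ t)
    have e2 := Finset.sum_sdiff (f := fun i => b i ^ 2) (Finset.subset_univ (Finset.Iio c))
    have e3 := Finset.sum_inter_add_sum_sdiff t (Finset.Iio c) (fun i => b i ^ 2)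
    have e4 := Finset.sum_inter_add_sum_sdiff (Finset.Iio c) t (fun i => b i ^ 2)
    rw [Finset.inter_comm] at e4
    linarith

theorem card_filter_val_succ_lt {n k : ℕ} (hk : 0 < k) :
    (Finset.univ.filter fun i : Fin n => i.val + 1 < k).card < k := by
  have h := Finset.card_le_card_of_injOn (s := Finset.univ.filter fun i : Fin n => i.val + 1 < k)
    (t := Finset.range (k - 1)) Fin.val (fun i hi => by
      have : i.val + 1 < k := by simpa using hi
      simp; omega) (Fin.val_injective.injOn)
  rw [Finset.card_range] at h
  omega

theorem inv_sqrt_two_mul_sum_le_radMean_rpow {n : ℕ} {b : Fin n → ℝ} (h0 : ∀ i, 0 ≤ b i) {p : ℝ} (hp : 2 ≤ p) :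
    1 / Real.sqrt 2 * ∑ i with i.val + 1 < ⌈p / 2⌉₊, b i
      ≤ radMean b Finset.univ (fun x => |x| ^ p) ^ p⁻¹ := by
  have hp0 : 0 < p := by linarith
  set H := Finset.univ.filter fun i : Fin n => i.val + 1 < ⌈p / 2⌉₊
  set X := ∑ i ∈ H, b i
  have hX : 0 ≤ X := Finset.sum_nonneg fun i _ => h0 i
  have hH : (H.card : ℝ) < p / 2 :=
    Nat.lt_ceil.1 (card_filter_val_succ_lt (Nat.ceil_pos.2 (by linarith)))
  have h1 : X ^ p / 2 ^ H.card ≤ radMean b Finset.univ (fun x => |x| ^ p) := by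
    refine le_trans ?_ (radMean_le_of_subset (abs_rpow_midpoint_le (by linarith))
      (Finset.subset_univ H))
    have := div_two_pow_le_radMean (a := b) (s := H) (f := fun x => |x| ^ p)
      fun x => by positivity
    rwa [abs_of_nonneg hX] at this
  -- Since (√2)^p = 2^(p/2), the bound |H| < p/2 is what is needed.
  have h2 : (1 / Real.sqrt 2 * X) ^ p ≤ X ^ p / 2 ^ H.card := by
    have hs : (Real.sqrt 2) ^ p = 2 ^ (p / 2) := by
      rw [Real.sqrt_eq_rpow, ← Real.rpow_mul (by norm_num)]; congr 1; ring
    rw [one_div_mul_eq_div, Real.div_rpow hX (Real.sqrt_nonneg _), hs, ← Real.rpow_natCast 2]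
    gcongr
    norm_num
  have h3 := Real.rpow_le_rpow (by positivity) (h2.trans h1) (inv_nonneg.2 hp0.le)
  rwa [Real.rpow_rpow_inv (by positivity) hp0.ne'] at h3

theorem corollary1 {Ω : Type*} [MeasurableSpace Ω] (μ : Measure Ω) [IsProbabilityMeasure μ]
    (n : ℕ) (ε : Fin n → Ω → ℝ) (hε : IsBernoulliFamily μ ε) (a : Fin n → ℝ)
    (p : ℝ) (hp : 2 ≤ p) :
    MemLp (fun ω => ∑ i, a i * ε i ω) (ENNReal.ofReal p) μ ∧
    max
        (gaussianNorm p *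
          Real.sqrt (∑ i with ⌈p / 2⌉₊ ≤ i.val + 1, nonincRearrangement a i ^ 2))
        (1 / Real.sqrt 2 * ∑ i with i.val + 1 < ⌈p / 2⌉₊, nonincRearrangement a i)
      ≤ lpNorm (fun ω => ∑ i, a i * ε i ω) (ENNReal.ofReal p) μ ∧
    lpNorm (fun ω => ∑ i, a i * ε i ω) (ENNReal.ofReal p) μ
      ≤ gaussianNorm p *
          Real.sqrt (∑ i with ⌈p / 2⌉₊ ≤ i.val + 1, nonincRearrangement a i ^ 2) +
        ∑ i with i.val + 1 < ⌈p / 2⌉₊, nonincRearrangement a i := by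
  have hp0 : 0 < p := by linarith
  refine ⟨hε.memLp a _ _, ?_⟩
  set b := nonincRearrangement a
  set e := Tuple.sort (fun j => -|a j|)
  have hbanti : Antitone b := nonincRearrangement_antitone a
  have hb0 : ∀ i, 0 ≤ b i := fun i => abs_nonneg _
  have hb : b = fun i => |a (e i)| := rfl
  -- The signs are permuted along with the coefficients, so the sum itself is unchanged.
  have hε' : IsBernoulliFamily μ (fun i => ε (e i)) :=
    ⟨fun i => hε.measurable _, fun i => hε.prob_one _, fun i => hε.prob_neg_one _,
      hε.indep.precomp e.injective⟩
  have hsum : (fun ω => ∑ i, a i * ε i ω) = fun ω => ∑ i, a (e i) * ε (e i) ω := by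
    funext ω
    exact (Equiv.sum_comp e fun i => a i * ε i ω).symm
  rw [hsum]
  have hnorm : lpNorm (fun ω => ∑ i, a (e i) * ε (e i) ω) (ENNReal.ofReal p) μ
      = radMean b Finset.univ (fun x => |x| ^ p) ^ p⁻¹ := by
    rw [hε'.lpNorm_eq (fun i => a (e i)) Finset.univ hp0, hb, radMean_abs]
  refine ⟨max_le ?_ ?_, ?_⟩
  · have hv : 0 ≤ ∑ i with ⌈p / 2⌉₊ ≤ i.val + 1, b i ^ 2 := Finset.sum_nonneg fun i _ => sq_nonneg _
    rw [hnorm, ← rpow_mul_gaussianMoment_rpow_inv hp0 hv]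
    refine Real.rpow_le_rpow (mul_nonneg (Real.rpow_nonneg hv _) (gaussianMoment_nonneg p)) ?_
      (inv_nonneg.2 hp0.le)
    exact rpow_mul_gaussianMoment_le_radMean hp (fun i _ => hb0 i) hv
      fun t _ ht => sum_tail_sq_le_sum_sdiff hbanti hb0 (Nat.lt_ceil.2 ht)
  · rw [hnorm]
    exact inv_sqrt_two_mul_sum_le_radMean_rpow hb0 hp
  · have hsq : ∀ i, b i ^ 2 = a (e i) ^ 2 := fun i => sq_abs _
    have htail : (Finset.univ.filter fun i : Fin n => ⌈p / 2⌉₊ ≤ i.val + 1)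
        = Finset.univ \ Finset.univ.filter fun i : Fin n => i.val + 1 < ⌈p / 2⌉₊ := by
      ext i; simp
    rcases le_or_gt 4 p with hp4 | hp4
    · rw [htail]
      simp only [hsq]
      exact hε'.lpNorm_le_of_four_le (fun i => a (e i)) (Finset.subset_univ _) hp4
    rcases eq_or_lt_of_le hp with rfl | hp2
    · rw [hnorm]
      simp [radMean_sq, gaussianNorm_two, Real.sqrt_eq_rpow]
    · have hk : ⌈p / 2⌉₊ = 2 := by
        rw [Nat.ceil_eq_iff (by norm_num)]
        constructor <;> norm_num <;> linarith
      rcases n with _ | n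
      · simp
      · have hhead : (Finset.univ.filter fun i : Fin (n + 1) => i.val + 1 < ⌈p / 2⌉₊) = {0} := by
          ext i
          simp only [Finset.mem_filter, Finset.mem_univ, true_and, Finset.mem_singleton, hk,
            Fin.ext_iff, Fin.val_zero]
          omega
        rw [htail, hhead, Finset.sdiff_singleton_eq_erase, Finset.sum_singleton]
        simp only [hsq]
        exact hε'.lpNorm_le_of_lt_four (fun i => a (e i)) (Finset.mem_univ 0)
          (fun i _ => hbanti (Fin.zero_le i)) hp2 hp4
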